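/- Let $\mathcal E$ be an unknown $n$-qubit quantum process (a completely positive trace-preserving map on $2^n\times 2^n$ matrices) with normalized Choi state $\rho_\Lambda=2^{-n}\sum_{x,y\in\{0,1\}^n}|x\rangle\langle y|\otimes\mathcal E(|x\rangle\langle y|)$, a state of $2n$ qubits. Let $(\rho_1,\sigma_1),\dots,(\rho_M,\sigma_M)$ be pairs of $n$-qubit density matrices, $O_i=\rho_i^{T}\otimes\sigma_i$, and $\epsilon,\delta\in(0,1)$. A measurement primitive is a probability distribution $\mathcal U$ on the unitaries of $2n$ qubits. One measurement prepares $\rho_\Lambda$, draws $U\sim\mathcal U$, applies it, and reads a bit string $b\in\{0,1\}^{2n}$ in the computational basis, so that $b$ has probability $\langle b|U\rho_\Lambda U^\dagger|b\rangle$. Let $\mathcal M(A)=\mathbb E_{U\sim\mathcal U}\sum_b\langle b|UAU^\dagger|b\rangle\,U^\dagger|b\rangle\langle b|U$ be the measurement channel. $\mathcal U$ is called tomographically complete if $\mathcal M$ is invertible. In that case the classical shadow of a record $(U,b)$ is $\hat\rho=\mathcal M^{-1}(U^\dagger|b\rangle\langle b|U)$, and the shadow norm is $$\|A\|_{\mathrm{shadow}}=\max_{\tau\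 \text{state}}\Bigl(\mathbb E_{U\sim\mathcal U}\sum_b\langle b|U\tau U^\dagger|b\rangle\,\langle b|U\mathcal M^{-1}(A)U^\dagger|b\rangle^2\Bigr)^{1/2}.$$ Set $V$ as follows. (a) For an arbitrary tomographically complete primitive, $V=\max_i\bigl\|O_i-\tfrac{\operatorname{tr}(O_i)}{2}\mathbb I\bigr\|_{\mathrm{shadow}}^2$; alternatively $V=\max_i\bigl\|O_i-\tfrac{\operatorname{tr}(O_i)}{2^{2n}}\mathbb I\bigr\|_{\mathrm{shadow}}^2$. (b) For random global Clifford measurements ($U$ uniform in the Clifford group on $2n$ qubits), $V=\max_i\operatorname{tr}(O_i^2)$. (c) For random single-qubit Clifford measurements ($U=\bigotimes_q u_q$ with independent uniform single-qubit Cliffords $u_q$), $V=\max_i 4^{k_i}\|O_i\|_\infty^2$, where $k_i$ is the number of qubits on which $O_i$ acts nontrivially and $\|\cdot\|_\infty$ is the spectral norm. Then in each of these cases the following holds. 1. Let $K$ and $N\ge 1$ be integers with $K\ge 2\log(2M/\delta)$ and $N\ge\frac{34}{\epsilon^2}V$. For every process $\mathcal E$, take $NK$ independent classical shadows of $\rho_\Lambda$,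 split into $K$ batches of size $N$, and let $\hat o_i$ be the median of the $K$ batch means of $\operatorname{tr}(O_i\hat\rho)$. With probability at least $1-\delta$, $|\hat o_i-\operatorname{tr}((\rho_i^{T}\otimes\sigma_i)\rho_\Lambda)|\le\epsilon$ for all $i$ simultaneously. 2. $O\bigl(\frac{\log(2M/\delta)}{\epsilon^2}V\bigr)$ measurements suffice. That is, there is an absolute constant $C>0$ such that for every integer $T\ge C\,\frac{\log(2M/\delta)}{\epsilon^2}V$ there is an estimator, a function of the records of $T$ independent measurements, which for every process $\mathcal E$ is within $\epsilon$ of $\operatorname{tr}((\rho_i^{T}\otimes\sigma_i)\rho_\Lambda)$ for all $i$ simultaneously with probability at least $1-\delta$. Moreover, if $\rho_i$ and $\sigma_i$ are pure, then $\operatorname{tr}(O_i^2)=1$ and $\|O_i\|_\infty^2=1$. -/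

import Mathlib

open MeasureTheory ProbabilityTheory
open scoped Matrix Kronecker ComplexOrder

noncomputable section

namespace ShadowQPT

/-- Computational basis labels (bit strings) of a register whose qubits are indexed by `ι`. -/
abbrev Bits (ι : Type) : Type := ι → Fin 2

/-- Operators on the register `ι`. -/
abbrev Op (ι : Type) : Type := Matrix (Bits ι) (Bits ι) ℂ

/-- Unitaries on the register `ι`. -/
abbrev Unitaries (ι : Type) [Fintype ι] [DecidableEq ι] : Type :=
  ↥(Matrix.unitaryGroup (Bits ι) ℂ)

instance instMeasurableSpaceOp (ι : Type) : MeasurableSpace (Op ι) :=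
  inferInstanceAs (MeasurableSpace (Bits ι → Bits ι → ℂ))

instance instMeasurableSpaceUnitaries (ι : Type) [Fintype ι] [DecidableEq ι] :
    MeasurableSpace (Unitaries ι) :=
  MeasurableSpace.comap (fun U : Unitaries ι => (U : Op ι)) inferInstance

/-! ### States, channels, Choi states -/

/-- Density matrices. -/
def IsDensity {ι : Type} [Fintype ι] [DecidableEq ι] (A : Op ι) : Prop :=
  A.PosSemidef ∧ A.trace = 1

/-- Pure states `|ψ⟩⟨ψ|`, with `ψ` a unit vector. -/
def IsPure {ι : Type} [Fintype ι] [DecidableEq ι] (A : Op ι) : Prop :=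
  ∃ ψ : Bits ι → ℂ, star ψ ⬝ᵥ ψ = 1 ∧ A = Matrix.vecMulVec ψ (star ψ)

/-- The map `id_k ⊗ E`, acting blockwise. -/
def ampliate {ι : Type} (E : Op ι →ₗ[ℂ] Op ι) (k : ℕ)
    (X : Matrix (Fin k × Bits ι) (Fin k × Bits ι) ℂ) :
    Matrix (Fin k × Bits ι) (Fin k × Bits ι) ℂ :=
  Matrix.of fun p q => E (Matrix.of fun x y => X (p.1, x) (q.1, y)) p.2 q.2

/-- Quantum processes: completely positive trace-preserving linear maps. -/
def IsQuantumChannel {ι : Type} [Fintype ι] [DecidableEq ι] (E : Op ι →ₗ[ℂ] Op ι) : Prop :=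
  (∀ (k : ℕ) (X : Matrix (Fin k × Bits ι) (Fin k × Bits ι) ℂ),
    X.PosSemidef → (ampliate E k X).PosSemidef) ∧
  ∀ A : Op ι, (E A).trace = A.trace

/-- The operator `A ⊗ B` on the joint register `ι ⊕ κ`. -/
def tensor {ι κ : Type} (A : Op ι) (B : Op κ) : Op (ι ⊕ κ) :=
  (A ⊗ₖ B).submatrix (Equiv.sumArrowEquivProdArrow ι κ (Fin 2))
    (Equiv.sumArrowEquivProdArrow ι κ (Fin 2))

/-- The normalized Choi matrix
`2⁻ⁿ (id ⊗ E)(∑ |x⟩⟨y| ⊗ |x⟩⟨y|) = 2⁻ⁿ ∑ |x⟩⟨y| ⊗ E(|x⟩⟨y|)`. -/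
def choiState {n : ℕ} (E : Op (Fin n) →ₗ[ℂ] Op (Fin n)) : Op (Fin n ⊕ Fin n) :=
  ((2 : ℂ) ^ n)⁻¹ •
    ∑ x : Bits (Fin n), ∑ y : Bits (Fin n),
      tensor (Matrix.single x y (1 : ℂ)) (E (Matrix.single x y (1 : ℂ)))

/-! ### Measurement primitives, classical shadows, shadow norm

A measurement primitive is a probability measure `μ` on the unitaries of the register. -/

section Shadow

variable {ι : Type} [Fintype ι] [DecidableEq ι]

/-- The projector `U† |b⟩⟨b| U`. -/
def snapshot (U : Unitaries ι) (b : Bits ι) : Op ι :=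
  (U : Op ι)ᴴ * Matrix.single b b (1 : ℂ) * (U : Op ι)

/-- `⟨b| U A U† |b⟩`. -/
def diagEntry (U : Unitaries ι) (b : Bits ι) (A : Op ι) : ℂ :=
  ((U : Op ι) * A * (U : Op ι)ᴴ) b b

/-- The measurement channel `A ↦ 𝔼_U ∑_b ⟨b|U A U†|b⟩ U†|b⟩⟨b|U` (expectation entrywise). -/
def measurementChannel (μ : Measure (Unitaries ι)) (A : Op ι) : Op ι :=
  Matrix.of fun x y => ∫ U, ∑ b, diagEntry U b A * snapshot U b x y ∂μ

/-- The measurement primitive is tomographically complete: its channel is invertible. -/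
def TomographicallyComplete (μ : Measure (Unitaries ι)) : Prop :=
  Function.Bijective (measurementChannel μ)

/-- The inverse `𝓜⁻¹` of the measurement channel. -/
def inverseChannel (μ : Measure (Unitaries ι)) : Op ι → Op ι :=
  Function.invFun (measurementChannel μ)

/-- The shadow norm
`max_τ (𝔼_U ∑_b ⟨b|U τ U†|b⟩ ⟨b|U 𝓜⁻¹(A) U†|b⟩²)^{1/2}`, with `τ` ranging over all states. -/
def shadowNorm (μ : Measure (Unitaries ι)) (A : Op ι) : ℝ :=
  ⨆ τ : {τ : Op ι // IsDensity τ},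
    Real.sqrt (∫ U, ∑ b, (diagEntry U b τ.1).re * (diagEntry U b (inverseChannel μ A)).re ^ 2 ∂μ)

/-- The joint law of `(U, b)` in one measurement of the state `ρ`: `U` is drawn from `μ`,
and then `b` is observed with probability `⟨b|U ρ U†|b⟩`. -/
def shotLaw (μ : Measure (Unitaries ι)) (ρ : Op ι) : Measure (Unitaries ι × Bits ι) :=
  ∑ b : Bits ι,
    (μ.withDensity fun U => ENNReal.ofReal (diagEntry U b ρ).re).map fun U => (U, b)

/-- The classical shadow `𝓜⁻¹(U†|b⟩⟨b|U)` of one measurement record. -/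
def classicalShadow (μ : Measure (Unitaries ι)) (z : Unitaries ι × Bits ι) : Op ι :=
  inverseChannel μ (snapshot z.1 z.2)

/-- The mean, over the `k`-th batch of `B` records, of the estimates `tr(A ρ̂)`. -/
def batchMean (μ : Measure (Unitaries ι)) (A : Op ι) {K B : ℕ}
    (ω : Fin K × Fin B → Unitaries ι × Bits ι) (k : Fin K) : ℝ :=
  (∑ j : Fin B, (A * classicalShadow μ (ω (k, j))).trace.re) / B

/-- `m` is a median of `v 0, …, v (K-1)`: at least half of the values are `≤ m` and at least half
are `≥ m`. (For even `K` this admits every usual convention.) -/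
def IsMedian {K : ℕ} (v : Fin K → ℝ) (m : ℝ) : Prop :=
  K ≤ 2 * {k : Fin K | v k ≤ m}.ncard ∧ K ≤ 2 * {k : Fin K | m ≤ v k}.ncard

end Shadow

/-- For every `n`-qubit process `E`, median-of-means prediction from `K` batches of `B` independent
classical shadows of the Choi state of `E` is within `ε` of `tr(O_i ρ_Λ)` for all `i`
simultaneously, with probability at least `1 - δ`. -/
def MedianOfMeansPredicts {n M : ℕ} (μ : Measure (Unitaries (Fin n ⊕ Fin n)))
    (O : Fin M → Op (Fin n ⊕ Fin n)) (ε δ : ℝ) (K B : ℕ) : Prop :=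
  ∀ E : Op (Fin n) →ₗ[ℂ] Op (Fin n), IsQuantumChannel E →
    ENNReal.ofReal (1 - δ) ≤
      Measure.pi (fun _ : Fin K × Fin B => shotLaw μ (choiState E))
        {ω | ∀ i : Fin M, ∀ m : ℝ, IsMedian (batchMean μ (O i) ω) m →
          |m - (O i * choiState E).trace.re| ≤ ε}

/-- `T` independent measurements of the Choi state suffice: some estimator, which depends on the
process only through the `T` measurement records, is for every `n`-qubit process within `ε` of
`tr(O_i ρ_Λ)` for all `i` simultaneously, with probability at least `1 - δ`. -/
def MeasurementsSuffice {n M : ℕ} (μ : Measure (Unitaries (Fin n ⊕ Fin n)))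
    (O : Fin M → Op (Fin n ⊕ Fin n)) (ε δ : ℝ) (T : ℕ) : Prop :=
  ∃ est : (Fin T → Unitaries (Fin n ⊕ Fin n) × Bits (Fin n ⊕ Fin n)) → Fin M → ℝ,
    Measurable est ∧
    ∀ E : Op (Fin n) →ₗ[ℂ] Op (Fin n), IsQuantumChannel E →
      ENNReal.ofReal (1 - δ) ≤
        Measure.pi (fun _ : Fin T => shotLaw μ (choiState E))
          {ω | ∀ i : Fin M, |est ω i - (O i * choiState E).trace.re| ≤ ε}

/-! ### Clifford measurements -/

/-- The Pauli matrices `I, X, Y, Z`. -/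
def pauli : Fin 4 → Matrix (Fin 2) (Fin 2) ℂ :=
  ![!![1, 0; 0, 1], !![0, 1; 1, 0], !![0, -Complex.I; Complex.I, 0], !![1, 0; 0, -1]]

/-- The tensor product of Pauli matrices. -/
def pauliString {ι : Type} [Fintype ι] (s : ι → Fin 4) : Op ι :=
  Matrix.of fun x y => ∏ q, pauli (s q) (x q) (y q)

/-- The Clifford unitaries: conjugation maps Pauli strings to Pauli strings up to sign. The global
phase, which is irrelevant for measurements, is restricted by `det U = 1`; every Clifford unitary
has exactly `2^|ι|` multiples by phases in this finite group. -/
def cliffordSet (ι : Type) [Fintype ι] [DecidableEq ι] : Set (Unitaries ι) :=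
  {U | (U : Op ι).det = 1 ∧ ∀ s : ι → Fin 4, ∃ t : ι → Fin 4,
    (U : Op ι) * pauliString s * (U : Op ι)ᴴ = pauliString t ∨
    (U : Op ι) * pauliString s * (U : Op ι)ᴴ = -pauliString t}

/-- The random global Clifford measurement primitive: a uniformly random Clifford unitary on the
whole register. -/
def globalClifford (ι : Type) [Fintype ι] [DecidableEq ι] : Measure (Unitaries ι) :=
  uniformOn (cliffordSet ι)

/-- The matrix of `⨂_q u_q` for single-qubit operators `u_q`. -/
def productOp {ι : Type} [Fintype ι] (u : ι → Op Unit) : Op ι :=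
  Matrix.of fun x y => ∏ q, u q (fun _ => x q) (fun _ => y q)

theorem productOp_mul {ι : Type} [Fintype ι] [DecidableEq ι] (u v : ι → Op Unit) :
    productOp u * productOp v = productOp fun q => u q * v q := by
  ext x y
  have h : ∀ q, (u q * v q) (fun _ => x q) (fun _ => y q) =
      ∑ a : Fin 2, u q (fun _ => x q) (fun _ => a) * v q (fun _ => a) (fun _ => y q) := by
    intro q
    rw [Matrix.mul_apply]
    exact Fintype.sum_equiv (Equiv.funUnique Unit (Fin 2)) _ _ (fun a => rfl)
  simp only [productOp, Matrix.mul_apply, Matrix.of_apply] at h ⊢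
  rw [Finset.prod_congr rfl fun q _ => h q, Finset.prod_univ_sum, Fintype.piFinset_univ]
  exact Finset.sum_congr rfl fun z _ => Finset.prod_mul_distrib.symm

theorem productOp_mem {ι : Type} [Fintype ι] [DecidableEq ι] (u : ι → Unitaries Unit) :
    productOp (fun q => (u q : Op Unit)) ∈ Matrix.unitaryGroup (Bits ι) ℂ := by
  have hs : star (productOp fun q => (u q : Op Unit)) =
      productOp fun q => star (u q : Op Unit) := by
    ext x y
    simp [productOp, Matrix.star_apply]
  rw [Matrix.mem_unitaryGroup_iff, hs, productOp_mul]
  ext x y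
  have h1 : ∀ q, (u q : Op Unit) * star (u q : Op Unit) = 1 := fun q =>
    Matrix.mem_unitaryGroup_iff.mp (u q).2
  have h2 : ∀ q, ((fun _ : Unit => x q) = fun _ => y q) ↔ x q = y q := fun q =>
    ⟨fun h => congrFun h (), fun h => by rw [h]⟩
  simp only [productOp, Matrix.of_apply, h1, Matrix.one_apply, h2]
  by_cases hxy : x = y
  · simp [hxy]
  · obtain ⟨q, hq⟩ := Function.ne_iff.mp hxy
    rw [if_neg hxy]
    exact Finset.prod_eq_zero (Finset.mem_univ q) (by simp [hq])

/-- The unitary `⨂_q u_q`. -/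
def productUnitary {ι : Type} [Fintype ι] [DecidableEq ι] (u : ι → Unitaries Unit) :
    Unitaries ι :=
  ⟨productOp fun q => (u q : Op Unit), productOp_mem u⟩

/-- The random single-qubit Clifford measurement primitive: `⨂_q u_q` with the `u_q` independent
and uniformly random single-qubit Clifford unitaries. -/
def singleQubitClifford (ι : Type) [Fintype ι] [DecidableEq ι] : Measure (Unitaries ι) :=
  (Measure.pi fun _ : ι => globalClifford Unit).map productUnitary

/-- `A` acts as the identity on all qubits outside `S`: it is `A' ⊗ I` for some operator `A'` on
the qubits in `S`. -/
def SupportedOn {ι : Type} [Fintype ι] (A : Op ι) (S : Finset ι) : Prop :=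
  ∃ A' : Op ↥S, ∀ x y : Bits ι,
    ((∀ q ∉ S, x q = y q) → A x y = A' (fun q => x q) (fun q => y q)) ∧
    ((∃ q ∉ S, x q ≠ y q) → A x y = 0)

/-- The number of qubits on which `A` acts nontrivially. -/
def locality {ι : Type} [Fintype ι] (A : Op ι) : ℕ :=
  sInf {k | ∃ S : Finset ι, S.card = k ∧ SupportedOn A S}

/-- The spectral norm. -/
def spectralNorm {ι : Type} [Fintype ι] [DecidableEq ι] (A : Op ι) : ℝ :=
  ‖Matrix.toEuclideanCLM (𝕜 := ℂ) A‖

end ShadowQPT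

end

noncomputable section

namespace ShadowQPT

/-! ### Concentration of the median of means. -/

section MedianOfMeans

variable {Z : Type*} [MeasurableSpace Z] (ν : Measure Z) [IsProbabilityMeasure ν]

/-! The measurement channel 𝓜 is self-adjoint for the trace pairing, so a shadow predicts tr(O ρ̂) =
⟨b|U 𝓜⁻¹(O) U†|b⟩, with mean tr(O ρ_Λ). It is also unital, so replacing O by O - c·1 only shifts the
prediction by c. Hence for every real c the variance of the prediction is at most the `shadowMoment`
of O - c·1, and each case needs only one c for which this moment is at most 3V.

Given that bound, Chebyshev makes a batch of N ≥ 34V/ε² shadows bad (off by more than ε) with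
probability at most 3/34 < 1/(4e). A union bound over the possible sets of bad batches shows that
half of the K batches are bad with probability at most e^{-K/2} ≤ δ/(2M), and a second union bound
runs over the M observables. Otherwise every median is within ε
(`medianOfMeansPredicts_of_shadowMoment_le`). The count of measurements follows by rounding K and N
up, except when V is so small that the constant c is already a good estimator
(`measurementsSuffice_of_shadowMoment_le`).

For an arbitrary primitive, the moment is at most the squared shadow norm by definition. For
Clifford primitives everything is computed in the Pauli basis: a Clifford unitary sends a Pauli
string, up to sign, to a string that is either diagonal or has zero diagonal, so Pauli strings are
eigenvectors of 𝓜. The eigenvalue `zProb` is the probability of becoming diagonal, and the moment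
involves only the joint probabilities `zProbPair` (`shadowMoment_eq_sum`).

Globally, invariance of the Clifford group under transvections makes these probabilities constant on
orbits, and Parseval sum rules determine their values. This gives the moment (D+1)/(D+2)·(2 tr(τA²)
+ tr(A²)) ≤ 3 tr(A²) for traceless A, where D is the dimension. Locally the probabilities factor
over qubits, and a Schur test with row sums 4^k bounds the moment by 4^k‖A‖². -/

theorem pi_map_uncurry (α β : Type*) [Fintype α] [Fintype β] :
    (Measure.pi fun _ : α => Measure.pi fun _ : β => ν).map (fun f (p : α × β) => f p.1 p.2) =
      Measure.pi fun _ : α × β => ν := by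
  refine (Measure.pi_eq fun s hs => ?_).symm
  rw [Measure.map_apply (by fun_prop) (MeasurableSet.univ_pi hs)]
  have h : (fun (f : α → β → Z) (p : α × β) => f p.1 p.2) ⁻¹' Set.univ.pi s =
      Set.univ.pi fun a => Set.univ.pi fun b => s (a, b) := by
    ext f
    simp [Set.mem_pi]
  rw [h, Measure.pi_pi]
  simp_rw [Measure.pi_pi]
  rw [Fintype.prod_prod_type]

/-- Lets an estimator ignore surplus records: any subfamily of independent shots is again
independent with the same law. -/
theorem pi_map_comp_injective {α β : Type*} [Fintype α] [Fintype β] {f : α → β}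
    (hf : Function.Injective f) :
    (Measure.pi fun _ : β => ν).map (fun ω a => ω (f a)) = Measure.pi fun _ : α => ν := by
  have := Measure.map_infinitePi_infinitePi_of_inj (P := fun _ : β => ν) hf
  rwa [Measure.infinitePi_eq_pi, Measure.infinitePi_eq_pi] at this

/-- Chebyshev's inequality for the mean of independent copies of `X`. -/
theorem pi_mean_deviation_le {X : Z → ℝ} (hX : MemLp X 2 ν) {c V ε : ℝ}
    (hV : ∫ z, (X z - c) ^ 2 ∂ν ≤ 3 * V) (hε : 0 < ε) {B : ℕ} (hB : 0 < B)
    (hBV : 34 / ε ^ 2 * V ≤ B) :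
    (Measure.pi fun _ : Fin B => ν) {ω | ε < |(∑ j, X (ω j)) / B - ∫ z, X z ∂ν|} ≤
      ENNReal.ofReal (3 / 34) := by
  have hB' : (0 : ℝ) < B := by exact_mod_cast hB
  set μ := Measure.pi fun _ : Fin B => ν
  have hmp : ∀ j : Fin B, MeasurePreserving (fun ω : Fin B → Z => ω j) μ ν := fun j =>
    measurePreserving_eval _ j
  have hmem : ∀ j : Fin B, MemLp (fun ω : Fin B → Z => X (ω j)) 2 μ := fun j =>
    hX.comp_measurePreserving (hmp j)
  have hsum : MemLp (∑ j : Fin B, fun ω : Fin B → Z => X (ω j)) 2 μ :=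
    memLp_finsetSum' _ fun j _ => hmem j
  -- Variance is invariant under shifts and at most the second moment, so the centre `c` is free and
  -- need not be the mean.
  have hvar1 : variance X ν ≤ 3 * V := by
    rw [← variance_sub_const hX.aestronglyMeasurable c]
    exact (variance_le_expectation_sq (hX.sub (memLp_const c)).aestronglyMeasurable).trans hV
  have hmean : ∫ ω, (∑ j : Fin B, fun ω : Fin B → Z => X (ω j)) ω ∂μ = B * ∫ z, X z ∂ν := by
    simp only [Finset.sum_apply]
    rw [integral_finsetSum _ fun j _ => (hmem j).integrable one_le_two]
    have : ∀ j : Fin B, ∫ ω, X (ω j) ∂μ = ∫ z, X z ∂ν := by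
      intro j
      rw [← (hmp j).map_eq, integral_map (hmp j).measurable.aemeasurable]
      rw [(hmp j).map_eq]
      exact hX.aestronglyMeasurable
    simp [this]
  have hcheb := meas_ge_le_variance_div_sq hsum (c := B * ε) (by positivity)
  rw [hmean, variance_sum_pi fun _ => hX] at hcheb
  refine (measure_mono ?_).trans (hcheb.trans (ENNReal.ofReal_le_ofReal ?_))
  · intro ω hω
    simp only [Set.mem_ofPred_eq, Finset.sum_apply] at hω ⊢
    have : (∑ j, X (ω j)) - B * ∫ z, X z ∂ν = B * ((∑ j, X (ω j)) / B - ∫ z, X z ∂ν) := by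
      field_simp
    rw [this, abs_mul, abs_of_pos hB']
    exact mul_le_mul_of_nonneg_left hω.le hB'.le
  · simp only [Finset.sum_const, Finset.card_univ, Fintype.card_fin, nsmul_eq_mul]
    rw [div_le_iff₀ (by positivity)]
    have h2 : 34 * V ≤ B * ε ^ 2 := by
      rw [div_mul_eq_mul_div, div_le_iff₀ (by positivity)] at hBV
      exact hBV
    nlinarith [mul_le_mul_of_nonneg_left hvar1 hB'.le, mul_le_mul_of_nonneg_left h2 hB'.le]

/-- Union bound over the sets `S` of at least K/2 indices that could all be bad. By independence
each has probability at most (3/34)^|S| ≤ (e⁻¹/4)^(K/2) = e^(-K/2) 2^(-K), and the factor 2^(-K)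
pays for the at most 2^K choices of `S`. -/
theorem pi_many_bad_le {Y : Type*} [MeasurableSpace Y] (μ : Measure Y) [IsProbabilityMeasure μ]
    {p : Set Y} [DecidablePred (· ∈ p)] (hp : μ p ≤ ENNReal.ofReal (3 / 34)) (K : ℕ) :
    (Measure.pi fun _ : Fin K => μ) {f | K ≤ 2 * (Finset.univ.filter fun k => f k ∈ p).card} ≤
      ENNReal.ofReal (Real.exp (-(K / 2 : ℝ))) := by
  classical
  set big : Finset (Finset (Fin K)) := Finset.univ.filter fun S => K ≤ 2 * S.card
  have hsub : {f : Fin K → Y | K ≤ 2 * (Finset.univ.filter fun k => f k ∈ p).card} ⊆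
      ⋃ S ∈ big, Set.univ.pi fun k => if k ∈ S then p else Set.univ := by
    intro f hf
    simp only [Set.mem_iUnion]
    refine ⟨Finset.univ.filter fun k => f k ∈ p, by simpa [big] using hf, ?_⟩
    intro k _
    by_cases hk : f k ∈ p <;> simp [hk]
  have hone : ∀ S ∈ big, (Measure.pi fun _ : Fin K => μ)
      (Set.univ.pi fun k => if k ∈ S then p else Set.univ) ≤
        ENNReal.ofReal (Real.exp (-(K / 2 : ℝ)) * (1 / 2) ^ K) := by
    intro S hS
    have hS' : K ≤ 2 * S.card := by simpa [big] using hS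
    rw [Measure.pi_pi]
    have : ∀ k, μ (if k ∈ S then p else Set.univ) = if k ∈ S then μ p else 1 := by
      intro k
      split_ifs <;> simp
    simp_rw [this]
    rw [Finset.prod_ite_mem, Finset.univ_inter, Finset.prod_const]
    refine (pow_le_pow_left' hp _).trans ?_
    rw [← ENNReal.ofReal_pow (by norm_num)]
    refine ENNReal.ofReal_le_ofReal ?_
    -- The reason for the constant 34: 3/34 ≈ 0.0882 lies just below 1/(4e) ≈ 0.0920.
    have he : (3 / 34 : ℝ) ≤ Real.exp (-1) * (1 / 2) ^ 2 := by
      have h1 := Real.exp_one_lt_d9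
      have h2 : Real.exp (-1) * Real.exp 1 = 1 := by rw [← Real.exp_add]; simp
      nlinarith [Real.exp_pos (-1)]
    refine (pow_le_pow_left₀ (by norm_num) he _).trans ?_
    rw [mul_pow, ← pow_mul, ← Real.exp_nat_mul]
    refine mul_le_mul (Real.exp_le_exp.mpr ?_)
      (pow_le_pow_of_le_one (by norm_num) (by norm_num) hS') (by positivity) (Real.exp_pos _).le
    have : (K : ℝ) ≤ 2 * S.card := by exact_mod_cast hS'
    linarith
  refine (measure_mono hsub).trans ((measure_biUnion_finset_le _ _).trans ?_)
  refine (Finset.sum_le_sum hone).trans ?_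
  rw [Finset.sum_const, nsmul_eq_mul]
  have hcard : big.card ≤ 2 ^ K := by
    refine (Finset.card_le_univ _).trans ?_
    simp
  calc (big.card : ENNReal) * ENNReal.ofReal (Real.exp (-(K / 2 : ℝ)) * (1 / 2) ^ K)
      ≤ ENNReal.ofReal (2 ^ K) * ENNReal.ofReal (Real.exp (-(K / 2 : ℝ)) * (1 / 2) ^ K) := by
        gcongr
        rw [← ENNReal.ofReal_natCast]
        exact ENNReal.ofReal_le_ofReal (by exact_mod_cast hcard)
    _ = ENNReal.ofReal (Real.exp (-(K / 2 : ℝ))) := by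
        rw [← ENNReal.ofReal_mul (by positivity)]
        congr 1
        rw [mul_left_comm, ← mul_pow]
        norm_num

/-- At least half of the batch means deviate from the expectation by more than `ε` with
exponentially small probability. -/
theorem pi_half_batches_bad_le {X : Z → ℝ} (hXm : Measurable X) (hX : MemLp X 2 ν) {c V ε : ℝ}
    (hV : ∫ z, (X z - c) ^ 2 ∂ν ≤ 3 * V) (hε : 0 < ε) {B : ℕ} (hB : 0 < B)
    (hBV : 34 / ε ^ 2 * V ≤ B) (K : ℕ) :
    (Measure.pi fun _ : Fin K × Fin B => ν)
      {ω | K ≤ 2 * (Finset.univ.filter fun k =>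
        ε < |(∑ j, X (ω (k, j))) / B - ∫ z, X z ∂ν|).card} ≤
      ENNReal.ofReal (Real.exp (-(K / 2 : ℝ))) := by
  classical
  have hcheb := pi_mean_deviation_le ν hX hV hε hB hBV
  have hp := pi_many_bad_le (Measure.pi fun _ : Fin B => ν) hcheb K
  rw [← pi_map_uncurry ν (Fin K) (Fin B), Measure.map_apply (by fun_prop)]
  · refine le_trans (le_of_eq ?_) hp
    congr 1
  · have hbad : ∀ k : Fin K, MeasurableSet {ω : Fin K × Fin B → Z |
        ε < |(∑ j, X (ω (k, j))) / B - ∫ z, X z ∂ν|} := by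
      intro k
      refine measurableSet_lt measurable_const ?_
      have : Measurable fun ω : Fin K × Fin B → Z => ∑ j, X (ω (k, j)) :=
        Finset.measurable_sum _ fun j _ => hXm.comp (measurable_pi_apply _)
      exact ((this.div_const _).sub_const _).abs
    have hcount : Measurable fun ω : Fin K × Fin B → Z => (Finset.univ.filter fun k =>
        ε < |(∑ j, X (ω (k, j))) / B - ∫ z, X z ∂ν|).card := by
      simp_rw [Finset.card_filter]
      exact Finset.measurable_sum _ fun k _ =>
        Measurable.ite (hbad k) measurable_const measurable_const
    exact measurableSet_le measurable_const (hcount.const_mul 2)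

/-- A measurable function of `K ≥ 1` reals which is `ε`-close to every point that is `ε`-close to
more than half of them. -/
theorem exists_measurable_median {K : ℕ} (hK : 0 < K) :
    ∃ med : (Fin K → ℝ) → ℝ, Measurable med ∧ ∀ (v : Fin K → ℝ) (m ε : ℝ),
      2 * (Finset.univ.filter fun k => ε < |v k - m|).card < K → |med v - m| ≤ ε := by
  classical
  set S : Finset (Finset (Fin K)) := Finset.powersetCard (K / 2 + 1) Finset.univ
  have hcard : ∀ s : S, s.1.card = K / 2 + 1 := fun s => (Finset.mem_powersetCard.mp s.2).2
  have hne : ∀ s : S, s.1.Nonempty := fun s => Finset.card_pos.mp (by rw [hcard]; omega)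
  have hS : (Finset.univ : Finset S).Nonempty := by
    have : S.Nonempty := Finset.powersetCard_nonempty.mpr (by simp; omega)
    simpa using this.attach
  -- The maximum over (K/2+1)-element sets of the minimum on the set is the (K/2+1)-th largest
  -- value; written this way it is visibly measurable.
  refine ⟨fun v => Finset.univ.sup' hS fun s => s.1.inf' (hne s) v, ?_, ?_⟩
  · have h1 : ∀ s : S, Measurable fun v : Fin K → ℝ => s.1.inf' (hne s) v := by
      intro s
      have : Measurable (s.1.inf' (hne s) fun k (v : Fin K → ℝ) => v k) :=
        Finset.inf'_induction (hne s) _ (fun _ hf _ hg => hf.inf hg)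
          fun k _ => measurable_pi_apply k
      convert this using 1
      ext v
      simp [Finset.inf'_apply]
    have h2 := Finset.measurable_sup' hS
      (f := fun (s : S) (v : Fin K → ℝ) => s.1.inf' (hne s) v) fun s _ => h1 s
    convert h2 using 1
    ext v
    exact (Finset.sup'_apply hS _ v).symm
  · intro v m ε hv
    set bad := Finset.univ.filter fun k => ε < |v k - m|
    have hgood : ∀ k, k ∉ bad → |v k - m| ≤ ε := fun k hk => by simpa [bad] using hk
    have hc : badᶜ.card = K - bad.card := by rw [Finset.card_compl, Fintype.card_fin]
    -- Fewer than K/2 bad indices leave a set of K/2 + 1 good ones, which bounds the maximum below.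
    -- No such set can consist of bad indices alone, which bounds it above.
    obtain ⟨s, hs, hsc⟩ := Finset.exists_subset_card_eq (s := badᶜ) (n := K / 2 + 1) (by omega)
    have hsS : s ∈ S := Finset.mem_powersetCard.mpr ⟨Finset.subset_univ _, hsc⟩
    rw [abs_le]
    constructor
    · have : m - ε ≤ Finset.univ.sup' hS fun s => s.1.inf' (hne s) v := by
        refine le_trans ?_ (Finset.le_sup' (fun s : S => s.1.inf' (hne s) v)
          (Finset.mem_univ ⟨s, hsS⟩))
        refine Finset.le_inf' _ _ fun k hk => ?_
        have := (abs_le.mp (hgood k (Finset.mem_compl.mp (hs hk)))).1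
        linarith
      linarith
    · have : (Finset.univ.sup' hS fun s => s.1.inf' (hne s) v) ≤ m + ε := by
        refine Finset.sup'_le _ _ fun t _ => ?_
        obtain ⟨k, hkt, hk⟩ : ∃ k ∈ t.1, k ∉ bad := by
          by_contra! h
          have := Finset.card_le_card (show t.1 ⊆ bad from h)
          rw [hcard] at this
          omega
        refine (Finset.inf'_le v hkt).trans ?_
        have := (abs_le.mp (hgood k hk)).2
        linarith
      linarith

end MedianOfMeans

/-! ### Diagonal entries and snapshots of a rotated operator. -/

section Register

variable {ι : Type} [Fintype ι] [DecidableEq ι]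

theorem snapshot_apply (U : Unitaries ι) (b x y : Bits ι) :
    snapshot U b x y = star ((U : Op ι) b x) * (U : Op ι) b y := by
  simp [snapshot, Matrix.mul_apply, Matrix.single_apply, ite_and, Finset.sum_ite_eq]

theorem diagEntry_eq_sum (U : Unitaries ι) (b : Bits ι) (A : Op ι) :
    diagEntry U b A = ∑ x, ∑ y, A x y * ((U : Op ι) b x * star ((U : Op ι) b y)) := by
  simp only [diagEntry, Matrix.mul_apply, Finset.sum_mul, Matrix.conjTranspose_apply]
  rw [Finset.sum_comm]
  exact Finset.sum_congr rfl fun x _ => Finset.sum_congr rfl fun y _ => by ring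

theorem diagEntry_eq_trace (U : Unitaries ι) (b : Bits ι) (A : Op ι) :
    diagEntry U b A = (A * snapshot U b).trace := by
  simp only [diagEntry_eq_sum, Matrix.trace, Matrix.diag, Matrix.mul_apply, snapshot_apply]
  exact Finset.sum_congr rfl fun x _ => Finset.sum_congr rfl fun y _ => by ring

theorem diagEntry_add (U : Unitaries ι) (b : Bits ι) (A B : Op ι) :
    diagEntry U b (A + B) = diagEntry U b A + diagEntry U b B := by
  simp [diagEntry_eq_trace, add_mul]

theorem diagEntry_sub (U : Unitaries ι) (b : Bits ι) (A B : Op ι) :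
    diagEntry U b (A - B) = diagEntry U b A - diagEntry U b B := by
  simp [diagEntry_eq_trace, sub_mul]

theorem diagEntry_smul (U : Unitaries ι) (b : Bits ι) (c : ℂ) (A : Op ι) :
    diagEntry U b (c • A) = c * diagEntry U b A := by
  simp [diagEntry_eq_trace]

theorem unitary_mul_conjTranspose (U : Unitaries ι) : (U : Op ι) * (U : Op ι)ᴴ = 1 :=
  Matrix.mem_unitaryGroup_iff.mp U.2

theorem unitary_conjTranspose_mul (U : Unitaries ι) : (U : Op ι)ᴴ * (U : Op ι) = 1 :=
  Matrix.mem_unitaryGroup_iff'.mp U.2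

theorem diagEntry_one (U : Unitaries ι) (b : Bits ι) : diagEntry U b 1 = 1 := by
  simp [diagEntry, unitary_mul_conjTranspose]

theorem sum_diagEntry (U : Unitaries ι) (A : Op ι) : ∑ b, diagEntry U b A = A.trace := by
  change ((U : Op ι) * A * (U : Op ι)ᴴ).trace = _
  rw [Matrix.trace_mul_comm, ← mul_assoc, unitary_conjTranspose_mul, one_mul]

theorem diagEntry_nonneg (U : Unitaries ι) (b : Bits ι) {τ : Op ι} (hτ : τ.PosSemidef) :
    0 ≤ diagEntry U b τ :=
  (hτ.mul_mul_conjTranspose_same (U : Op ι)).diag_nonneg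

theorem diagEntry_re_nonneg (U : Unitaries ι) (b : Bits ι) {τ : Op ι} (hτ : τ.PosSemidef) :
    0 ≤ (diagEntry U b τ).re :=
  (Complex.le_def.mp (diagEntry_nonneg U b hτ)).1

theorem diagEntry_im_eq_zero (U : Unitaries ι) (b : Bits ι) {τ : Op ι} (hτ : τ.PosSemidef) :
    (diagEntry U b τ).im = 0 :=
  (Complex.le_def.mp (diagEntry_nonneg U b hτ)).2.symm

theorem sum_diagEntry_re (U : Unitaries ι) {τ : Op ι} (hτ : IsDensity τ) :
    ∑ b, (diagEntry U b τ).re = 1 := by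
  rw [← Complex.re_sum, sum_diagEntry, hτ.2, Complex.one_re]

/-! ### Bounded measurable functions of a unitary -/

/-- Bounded measurable complex-valued functions. -/
def BoundedMeasurable {α : Type*} [MeasurableSpace α] (f : α → ℂ) : Prop :=
  Measurable f ∧ ∃ C, ∀ a, ‖f a‖ ≤ C

namespace BoundedMeasurable

variable {α : Type*} [MeasurableSpace α] {f g : α → ℂ}

theorem const (c : ℂ) : BoundedMeasurable fun _ : α => c :=
  ⟨measurable_const, ‖c‖, fun _ => le_rfl⟩

theorem mul (hf : BoundedMeasurable f) (hg : BoundedMeasurable g) :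
    BoundedMeasurable fun a => f a * g a := by
  obtain ⟨hf, C, hC⟩ := hf
  obtain ⟨hg, D, hD⟩ := hg
  refine ⟨hf.mul hg, C * D, fun a => ?_⟩
  rw [norm_mul]
  exact mul_le_mul (hC a) (hD a) (norm_nonneg _) ((norm_nonneg _).trans (hC a))

theorem sum {κ : Type*} [Fintype κ] {f : κ → α → ℂ} (hf : ∀ k, BoundedMeasurable (f k)) :
    BoundedMeasurable fun a => ∑ k, f k a := by
  choose hm C hC using hf
  exact ⟨Finset.measurable_sum _ fun k _ => hm k, ∑ k, C k, fun a =>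
    (norm_sum_le _ _).trans (Finset.sum_le_sum fun k _ => hC k a)⟩

theorem star (hf : BoundedMeasurable f) : BoundedMeasurable fun a => star (f a) := by
  obtain ⟨hf, C, hC⟩ := hf
  refine ⟨Complex.continuous_conj.measurable.comp hf, C, fun a => ?_⟩
  rw [norm_star]
  exact hC a

theorem ofReal_re (hf : BoundedMeasurable f) : BoundedMeasurable fun a => ((f a).re : ℂ) := by
  obtain ⟨hf, C, hC⟩ := hf
  refine ⟨Complex.measurable_ofReal.comp (Complex.measurable_re.comp hf), C, fun a => ?_⟩
  rw [Complex.norm_real]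
  exact (Complex.abs_re_le_norm _).trans (hC a)

theorem pow (hf : BoundedMeasurable f) (n : ℕ) : BoundedMeasurable fun a => f a ^ n := by
  obtain ⟨hf, C, hC⟩ := hf
  refine ⟨hf.pow_const n, C ^ n, fun a => ?_⟩
  rw [norm_pow]
  exact pow_le_pow_left₀ (norm_nonneg _) (hC a) n

theorem integrable (hf : BoundedMeasurable f) (μ : Measure α) [IsFiniteMeasure μ] :
    Integrable f μ := by
  obtain ⟨hf, C, hC⟩ := hf
  exact Integrable.of_bound hf.aestronglyMeasurable C (Filter.Eventually.of_forall hC)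

end BoundedMeasurable

theorem boundedMeasurable_entry (x y : Bits ι) :
    BoundedMeasurable fun U : Unitaries ι => (U : Op ι) x y := by
  refine ⟨?_, 1, fun U => entry_norm_bound_of_unitary U.2 x y⟩
  have h1 : Measurable fun U : Unitaries ι => (U : Op ι) := comap_measurable _
  have h2 : Measurable fun A : Bits ι → Bits ι → ℂ => A x y :=
    (measurable_pi_apply y).comp (measurable_pi_apply x)
  exact h2.comp h1

theorem boundedMeasurable_snapshot (b x y : Bits ι) :
    BoundedMeasurable fun U : Unitaries ι => snapshot U b x y := by
  simp_rw [snapshot_apply]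
  exact (boundedMeasurable_entry b x).star.mul (boundedMeasurable_entry b y)

theorem boundedMeasurable_diagEntry (b : Bits ι) (A : Op ι) :
    BoundedMeasurable fun U : Unitaries ι => diagEntry U b A := by
  simp_rw [diagEntry_eq_sum]
  exact .sum fun x => .sum fun y => (BoundedMeasurable.const _).mul
    ((boundedMeasurable_entry b x).mul (boundedMeasurable_entry b y).star)

/-! ### The measurement channel -/

variable (μ : Measure (Unitaries ι))

/-- The joint second moment `𝔼_U ∑_b ⟨b|U A U†|b⟩ ⟨b|U B U†|b⟩`. -/
theorem trace_mul_measurementChannel [IsFiniteMeasure μ] (A B : Op ι) :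
    (A * measurementChannel μ B).trace = ∫ U, ∑ b, diagEntry U b A * diagEntry U b B ∂μ := by
  have hint : ∀ x y, BoundedMeasurable fun U : Unitaries ι =>
      ∑ b, diagEntry U b B * snapshot U b x y := fun x y =>
    .sum fun b => (boundedMeasurable_diagEntry b B).mul (boundedMeasurable_snapshot b x y)
  have hpt : ∀ U : Unitaries ι, ∑ b, diagEntry U b A * diagEntry U b B =
      ∑ x, ∑ y, A x y * ∑ b, diagEntry U b B * snapshot U b y x := by
    intro U
    have h1 : ∑ b, diagEntry U b A * diagEntry U b B =
        (A * ∑ b, diagEntry U b B • snapshot U b).trace := by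
      simp [Finset.mul_sum, Matrix.trace_sum, diagEntry_eq_trace U _ A, mul_comm]
    rw [h1]
    simp only [Matrix.trace, Matrix.diag, Matrix.mul_apply, Matrix.sum_apply, Matrix.smul_apply,
      smul_eq_mul]
  simp_rw [hpt]
  have hxy : ∀ x y, BoundedMeasurable fun U : Unitaries ι =>
      A x y * ∑ b, diagEntry U b B * snapshot U b y x := fun x y =>
    (BoundedMeasurable.const _).mul (hint y x)
  rw [integral_finsetSum _ fun x _ => (BoundedMeasurable.sum (hxy x)).integrable μ]
  refine Finset.sum_congr rfl fun x _ => ?_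
  rw [integral_finsetSum _ fun y _ => (hxy x y).integrable μ]
  refine Finset.sum_congr rfl fun y _ => ?_
  rw [integral_const_mul]
  rfl

/-- The joint second moment is symmetric in `A` and `B`. This moves the channel, and hence its
inverse, from the shadow to the observable. -/
theorem trace_mul_measurementChannel_comm [IsFiniteMeasure μ] (A B : Op ι) :
    (A * measurementChannel μ B).trace = (measurementChannel μ A * B).trace := by
  rw [Matrix.trace_mul_comm (measurementChannel μ A), trace_mul_measurementChannel,
    trace_mul_measurementChannel]
  simp_rw [mul_comm]

theorem measurementChannel_add [IsFiniteMeasure μ] (A B : Op ι) :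
    measurementChannel μ (A + B) = measurementChannel μ A + measurementChannel μ B := by
  ext x y
  simp only [measurementChannel, Matrix.of_apply, Matrix.add_apply]
  rw [← integral_add]
  · simp_rw [diagEntry_add, add_mul, Finset.sum_add_distrib]
  all_goals exact (BoundedMeasurable.sum fun b =>
    (boundedMeasurable_diagEntry b _).mul (boundedMeasurable_snapshot b x y)).integrable μ

theorem measurementChannel_smul (c : ℂ) (A : Op ι) :
    measurementChannel μ (c • A) = c • measurementChannel μ A := by
  ext x y
  simp only [measurementChannel, Matrix.of_apply, Matrix.smul_apply, smul_eq_mul]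
  rw [← integral_const_mul]
  simp_rw [diagEntry_smul, mul_assoc, Finset.mul_sum]

/-- The measurement channel as a linear map. -/
def measurementLinear [IsFiniteMeasure μ] : Op ι →ₗ[ℂ] Op ι where
  toFun := measurementChannel μ
  map_add' := measurementChannel_add μ
  map_smul' := measurementChannel_smul μ

theorem sum_snapshot (U : Unitaries ι) : ∑ b, snapshot U b = 1 := by
  ext x y
  rw [← unitary_conjTranspose_mul U, Matrix.sum_apply, Matrix.mul_apply]
  simp [snapshot_apply]

theorem measurementChannel_one [IsProbabilityMeasure μ] : measurementChannel μ (1 : Op ι) = 1 := by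
  ext x y
  simp only [measurementChannel, Matrix.of_apply, diagEntry_one, one_mul, ← Matrix.sum_apply,
    sum_snapshot]
  simp

variable {μ}

theorem measurementChannel_inverseChannel (h : TomographicallyComplete μ) (A : Op ι) :
    measurementChannel μ (inverseChannel μ A) = A :=
  Function.rightInverse_invFun h.2 A

theorem inverseChannel_measurementChannel (h : TomographicallyComplete μ) (A : Op ι) :
    inverseChannel μ (measurementChannel μ A) = A :=
  Function.leftInverse_invFun h.1 A

theorem inverseChannel_eq_of (h : TomographicallyComplete μ) {A B : Op ι}
    (hAB : measurementChannel μ B = A) : inverseChannel μ A = B := by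
  rw [← hAB, inverseChannel_measurementChannel h]

/-- The channel is linear and unital. Hence centring an observable shifts all its single-shot
predictions by the same constant. -/
theorem inverseChannel_sub_smul_one [IsProbabilityMeasure μ] (h : TomographicallyComplete μ)
    (A : Op ι) (c : ℂ) : inverseChannel μ (A - c • 1) = inverseChannel μ A - c • 1 := by
  refine inverseChannel_eq_of h ?_
  have : measurementLinear μ (inverseChannel μ A - c • 1) = A - c • 1 := by
    rw [map_sub, map_smul]
    change measurementChannel μ _ - c • measurementChannel μ 1 = _
    rw [measurementChannel_inverseChannel h, measurementChannel_one]
  exact this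

/-- The prediction of one classical shadow, `tr(A ρ̂) = ⟨b|U 𝓜⁻¹(A) U†|b⟩`. -/
theorem trace_mul_classicalShadow [IsFiniteMeasure μ] (h : TomographicallyComplete μ) (A : Op ι)
    (z : Unitaries ι × Bits ι) :
    (A * classicalShadow μ z).trace = diagEntry z.1 z.2 (inverseChannel μ A) := by
  conv_lhs => rw [← measurementChannel_inverseChannel h A]
  rw [← trace_mul_measurementChannel_comm, classicalShadow, measurementChannel_inverseChannel h,
    diagEntry_eq_trace]

/-! ### The law of a measurement record -/

theorem measurable_of_forall_bits {α : Type*} [MeasurableSpace α] {g : Unitaries ι × Bits ι → α}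
    (hg : ∀ b, Measurable fun U => g (U, b)) : Measurable g :=
  measurable_from_prod_countable_left hg

variable (μ) in
theorem shotLaw_univ [IsProbabilityMeasure μ] {τ : Op ι} (hτ : IsDensity τ) :
    shotLaw μ τ Set.univ = 1 := by
  have hm : ∀ b, Measurable fun U : Unitaries ι => (diagEntry U b τ).re := fun b =>
    Complex.measurable_re.comp (boundedMeasurable_diagEntry b τ).1
  simp only [shotLaw, Measure.coe_finsetSum, Finset.sum_apply]
  have : ∀ b : Bits ι, ((μ.withDensity fun U => ENNReal.ofReal (diagEntry U b τ).re).map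
      fun U => (U, b)) Set.univ = ∫⁻ U, ENNReal.ofReal (diagEntry U b τ).re ∂μ := by
    intro b
    rw [Measure.map_apply (by fun_prop) MeasurableSet.univ, Set.preimage_univ,
      withDensity_apply _ MeasurableSet.univ, Measure.restrict_univ]
  simp_rw [this]
  rw [← lintegral_finsetSum _ fun b _ => (hm b).ennreal_ofReal]
  simp_rw [← ENNReal.ofReal_sum_of_nonneg fun b _ => diagEntry_re_nonneg _ b hτ.1,
    sum_diagEntry_re _ hτ]
  simp

theorem isProbabilityMeasure_shotLaw [IsProbabilityMeasure μ] {τ : Op ι} (hτ : IsDensity τ) :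
    IsProbabilityMeasure (shotLaw μ τ) :=
  ⟨shotLaw_univ μ hτ⟩

theorem integral_shotLaw [IsProbabilityMeasure μ] {τ : Op ι} (hτ : IsDensity τ)
    {g : Unitaries ι × Bits ι → ℝ} (hg : ∀ b, BoundedMeasurable fun U => (g (U, b) : ℂ)) :
    ∫ z, g z ∂(shotLaw μ τ) = ∫ U, ∑ b, (diagEntry U b τ).re * g (U, b) ∂μ := by
  have hm : ∀ b, Measurable fun U : Unitaries ι => (diagEntry U b τ).re := fun b =>
    Complex.measurable_re.comp (boundedMeasurable_diagEntry b τ).1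
  have hgb : ∀ b, Measurable fun U => g (U, b) := fun b => by
    have := Complex.measurable_re.comp (hg b).1
    simpa [Function.comp_def] using this
  have hgm : Measurable g := measurable_of_forall_bits hgb
  have hgbd : ∃ C, ∀ z, ‖g z‖ ≤ C := by
    choose h C hC using hg
    refine ⟨∑ b, |C b|, fun z => ?_⟩
    have := hC z.2 z.1
    rw [Complex.norm_real] at this
    exact this.trans ((le_abs_self _).trans
      (Finset.single_le_sum (f := fun b => |C b|) (fun b _ => abs_nonneg _) (Finset.mem_univ z.2)))
  obtain ⟨C, hC⟩ := hgbd
  have hprob := isProbabilityMeasure_shotLaw (μ := μ) hτ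
  have hint : Integrable g (shotLaw μ τ) :=
    Integrable.of_bound hgm.aestronglyMeasurable C (Filter.Eventually.of_forall hC)
  rw [shotLaw] at hint ⊢
  rw [integrable_finsetSum_measure] at hint
  rw [integral_finsetSum_measure fun b _ => hint b (Finset.mem_univ b)]
  have hint2 : ∀ b, Integrable (fun U => (diagEntry U b τ).re * g (U, b)) μ := by
    intro b
    have := ((boundedMeasurable_diagEntry b τ).ofReal_re.mul (hg b)).integrable μ
    simpa using this.re
  rw [integral_finsetSum _ fun b _ => hint2 b]
  refine Finset.sum_congr rfl fun b _ => ?_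
  rw [integral_map (by fun_prop) hgm.aestronglyMeasurable,
    integral_withDensity_eq_integral_toReal_smul (hm b).ennreal_ofReal (by simp)]
  simp_rw [ENNReal.toReal_ofReal (diagEntry_re_nonneg _ b hτ.1), smul_eq_mul]

/-! ### Mean and second moment of the prediction of a classical shadow -/

/-- The expression inside the shadow norm. -/
def shadowMoment (μ : Measure (Unitaries ι)) (τ A : Op ι) : ℝ :=
  ∫ U, ∑ b, (diagEntry U b τ).re * (diagEntry U b (inverseChannel μ A)).re ^ 2 ∂μ

theorem shadowMoment_nonneg {τ : Op ι} (hτ : IsDensity τ) (A : Op ι) : 0 ≤ shadowMoment μ τ A :=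
  integral_nonneg fun U => Finset.sum_nonneg fun b _ =>
    mul_nonneg (diagEntry_re_nonneg U b hτ.1) (sq_nonneg _)

theorem integral_trace_mul_classicalShadow [IsProbabilityMeasure μ]
    (h : TomographicallyComplete μ) {τ : Op ι} (hτ : IsDensity τ) (A : Op ι) :
    ∫ z, (A * classicalShadow μ z).trace.re ∂(shotLaw μ τ) = (A * τ).trace.re := by
  simp_rw [trace_mul_classicalShadow h]
  rw [integral_shotLaw hτ fun b => (boundedMeasurable_diagEntry b _).ofReal_re]
  have h1 : (A * τ).trace = ∫ U, ∑ b, diagEntry U b τ * diagEntry U b (inverseChannel μ A) ∂μ := by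
    rw [← trace_mul_measurementChannel, measurementChannel_inverseChannel h, Matrix.trace_mul_comm]
  have hint := (BoundedMeasurable.sum fun b => (boundedMeasurable_diagEntry b τ).mul
    (boundedMeasurable_diagEntry b (inverseChannel μ A))).integrable μ
  rw [h1]
  have h2 := integral_re hint
  simp only [RCLike.re_to_complex] at h2
  rw [← h2]
  refine integral_congr_ae (Filter.Eventually.of_forall fun U => ?_)
  simp only [Complex.re_sum, Complex.mul_re, diagEntry_im_eq_zero U _ hτ.1, zero_mul, sub_zero]

/-- The link between variance and shadow norm, for any real centre `c`. The traceless part is one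
choice, the weight tr(O)/2 another. -/
theorem integral_sq_trace_mul_classicalShadow_sub [IsProbabilityMeasure μ]
    (h : TomographicallyComplete μ) {τ : Op ι} (hτ : IsDensity τ) (A : Op ι) (c : ℝ) :
    ∫ z, ((A * classicalShadow μ z).trace.re - c) ^ 2 ∂(shotLaw μ τ) =
      shadowMoment μ τ (A - (c : ℂ) • 1) := by
  have hz : ∀ z : Unitaries ι × Bits ι, (A * classicalShadow μ z).trace.re - c =
      (diagEntry z.1 z.2 (inverseChannel μ (A - (c : ℂ) • 1))).re := by
    intro z
    rw [trace_mul_classicalShadow h, inverseChannel_sub_smul_one h, diagEntry_sub, diagEntry_smul,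
      diagEntry_one]
    simp
  simp_rw [hz]
  rw [integral_shotLaw hτ fun b => ?_, shadowMoment]
  have := (boundedMeasurable_diagEntry b (inverseChannel μ (A - (c : ℂ) • 1))).ofReal_re.pow 2
  simpa using this

theorem measurable_trace_mul_classicalShadow [IsProbabilityMeasure μ]
    (h : TomographicallyComplete μ) (A : Op ι) :
    Measurable fun z => (A * classicalShadow μ z).trace.re := by
  simp_rw [trace_mul_classicalShadow h]
  exact measurable_of_forall_bits fun b =>
    Complex.measurable_re.comp (boundedMeasurable_diagEntry b _).1

theorem memLp_trace_mul_classicalShadow [IsProbabilityMeasure μ] (h : TomographicallyComplete μ)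
    {τ : Op ι} (hτ : IsDensity τ) (A : Op ι) :
    MemLp (fun z => (A * classicalShadow μ z).trace.re) 2 (shotLaw μ τ) := by
  have hprob := isProbabilityMeasure_shotLaw (μ := μ) hτ
  choose hm C hC using fun b => boundedMeasurable_diagEntry b (inverseChannel μ A)
  refine MemLp.of_bound (measurable_trace_mul_classicalShadow h A).aestronglyMeasurable
    (∑ b, |C b|) (Filter.Eventually.of_forall fun z => ?_)
  rw [trace_mul_classicalShadow h]
  exact (Complex.abs_re_le_norm _).trans ((hC z.2 z.1).trans ((le_abs_self _).trans
    (Finset.single_le_sum (f := fun b => |C b|) (fun b _ => abs_nonneg _) (Finset.mem_univ z.2))))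

theorem shadowMoment_le_sq_shadowNorm [IsProbabilityMeasure μ] {τ : Op ι} (hτ : IsDensity τ)
    (A : Op ι) : shadowMoment μ τ A ≤ shadowNorm μ A ^ 2 := by
  have hle : Real.sqrt (shadowMoment μ τ A) ≤ shadowNorm μ A := by
    choose hm C hC using fun b => boundedMeasurable_diagEntry b (inverseChannel μ A)
    -- An unbounded real supremum would default to 0, so a bound uniform in the state is required.
    -- Outcome probabilities are at most 1 and the diagonal entries of 𝓜⁻¹(A) are bounded uniformly
    -- in `U`.
    refine le_ciSup (f := fun τ : {τ : Op ι // IsDensity τ} =>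
      Real.sqrt (shadowMoment μ τ.1 A)) ?_ ⟨τ, hτ⟩
    refine ⟨Real.sqrt (∑ b, C b ^ 2), ?_⟩
    rintro _ ⟨⟨σ, hσ⟩, rfl⟩
    refine Real.sqrt_le_sqrt ?_
    have hb : ∀ U : Unitaries ι, ∑ b, (diagEntry U b σ).re *
        (diagEntry U b (inverseChannel μ A)).re ^ 2 ≤ ∑ b, C b ^ 2 := by
      intro U
      refine Finset.sum_le_sum fun b _ => ?_
      have h1 : (diagEntry U b σ).re ≤ 1 := by
        rw [← sum_diagEntry_re U hσ]
        exact Finset.single_le_sum (f := fun b => (diagEntry U b σ).re)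
          (fun b _ => diagEntry_re_nonneg U b hσ.1) (Finset.mem_univ b)
      have h2 : (diagEntry U b (inverseChannel μ A)).re ^ 2 ≤ C b ^ 2 := by
        rw [← sq_abs]
        exact pow_le_pow_left₀ (abs_nonneg _) ((Complex.abs_re_le_norm _).trans (hC b U)) 2
      nlinarith [diagEntry_re_nonneg U b hσ.1, sq_nonneg (diagEntry U b (inverseChannel μ A)).re]
    have := integral_mono_of_nonneg (μ := μ) (Filter.Eventually.of_forall fun U =>
      Finset.sum_nonneg fun b _ => mul_nonneg (diagEntry_re_nonneg U b hσ.1)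
        (sq_nonneg (diagEntry U b (inverseChannel μ A)).re)) (integrable_const (∑ b, C b ^ 2))
      (Filter.Eventually.of_forall hb)
    simpa [shadowMoment] using this
  rw [← Real.sq_sqrt (shadowMoment_nonneg hτ A)]
  exact pow_le_pow_left₀ (Real.sqrt_nonneg _) hle 2

end Register

/-! ### The Choi state -/

theorem choiState_apply {n : ℕ} (E : Op (Fin n) →ₗ[ℂ] Op (Fin n)) (p q : Bits (Fin n ⊕ Fin n)) :
    choiState E p q = ((2 : ℂ) ^ n)⁻¹ *
      E (Matrix.single (p ∘ Sum.inl) (q ∘ Sum.inl) 1) (p ∘ Sum.inr) (q ∘ Sum.inr) := by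
  simp only [choiState, Matrix.smul_apply, smul_eq_mul, Matrix.sum_apply, tensor,
    Matrix.submatrix_apply, Matrix.kroneckerMap_apply, Equiv.sumArrowEquivProdArrow]
  congr 1
  simp [Matrix.single_apply, ite_and, Function.comp_def]

theorem isDensity_choiState {n : ℕ} {E : Op (Fin n) →ₗ[ℂ] Op (Fin n)} (hE : IsQuantumChannel E) :
    IsDensity (choiState E) := by
  constructor
  -- The Choi state is id ⊗ E applied to the projector on the maximally entangled vector `v`, up to
  -- normalization. Complete positivity is stated with an ancilla `Fin k`, so the bit strings of the
  -- reference register are enumerated.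
  · let e : Bits (Fin n) ≃ Fin (Fintype.card (Bits (Fin n))) := Fintype.equivFin _
    let v : Fin (Fintype.card (Bits (Fin n))) × Bits (Fin n) → ℂ :=
      fun p => if p.1 = e p.2 then 1 else 0
    have h := (hE.1 _ _ (Matrix.posSemidef_vecMulVec_self_star v)).submatrix
      fun p : Bits (Fin n ⊕ Fin n) => (e (p ∘ Sum.inl), p ∘ Sum.inr)
    have h2 := h.smul (a := ((2 : ℂ) ^ n)⁻¹) (by
      have : ((2 : ℂ) ^ n)⁻¹ = ((((2 : ℝ) ^ n)⁻¹ : ℝ) : ℂ) := by push_cast; rfl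
      rw [this]
      exact Complex.zero_le_real.mpr (by positivity))
    convert h2 using 1
    ext p q
    rw [choiState_apply]
    simp only [Matrix.smul_apply, smul_eq_mul, Matrix.submatrix_apply, ampliate, Matrix.of_apply]
    refine congrArg _ (congrFun (congrFun (congrArg E ?_) _) _)
    ext x y
    simp only [Matrix.single_apply, Matrix.of_apply, Matrix.vecMulVec_apply, v, Pi.star_apply,
      EmbeddingLike.apply_eq_iff_eq]
    split_ifs <;> simp_all
  · have h1 : (choiState E).trace = ((2 : ℂ) ^ n)⁻¹ *
        ∑ p : Bits (Fin n) × Bits (Fin n), E (Matrix.single p.1 p.1 1) p.2 p.2 := by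
      rw [Finset.mul_sum]
      simp only [Matrix.trace, Matrix.diag, choiState_apply]
      exact Fintype.sum_equiv (Equiv.sumArrowEquivProdArrow (Fin n) (Fin n) (Fin 2)) _ _
        fun p => rfl
    have h2 : ∀ x : Bits (Fin n), ∑ y, E (Matrix.single x x 1) y y = 1 := by
      intro x
      have := hE.2 (Matrix.single x x 1)
      rw [Matrix.trace_single_eq_same] at this
      exact this
    rw [h1, Fintype.sum_prod_type]
    simp [h2]

/-! ### From a bound on the shadow moment to the two prediction guarantees. -/

section Prediction

variable {n M : ℕ} {μ : Measure (Unitaries (Fin n ⊕ Fin n))} [IsProbabilityMeasure μ]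
  {O : Fin M → Op (Fin n ⊕ Fin n)} {c : Fin M → ℝ} {V ε δ : ℝ}

theorem log_two_mul_div_ge (hM : 0 < M) (hδ : 0 < δ) (hδ1 : δ < 1) :
    Real.log 2 ≤ Real.log (2 * M / δ) := by
  have hM' : (1 : ℝ) ≤ M := by exact_mod_cast hM
  refine Real.log_le_log (by norm_num) ?_
  rw [le_div_iff₀ hδ]
  nlinarith

/-- Simultaneously for all observables, fewer than half of the batch means are bad. -/
theorem one_sub_le_measure_batches_good (h : TomographicallyComplete μ) {τ : Op (Fin n ⊕ Fin n)}
    (hτ : IsDensity τ) (hV : ∀ i, shadowMoment μ τ (O i - (c i : ℂ) • 1) ≤ 3 * V)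
    (hε : 0 < ε) (hδ : 0 < δ) {K B : ℕ} (hK : 2 * Real.log (2 * M / δ) ≤ K) (hB : 0 < B)
    (hBV : 34 / ε ^ 2 * V ≤ B) :
    ENNReal.ofReal (1 - δ) ≤ Measure.pi (fun _ : Fin K × Fin B => shotLaw μ τ)
      {ω | ∀ i, 2 * (Finset.univ.filter fun k =>
        ε < |batchMean μ (O i) ω k - (O i * τ).trace.re|).card < K} := by
  have hprob := isProbabilityMeasure_shotLaw (μ := μ) hτ
  set P := Measure.pi (fun _ : Fin K × Fin B => shotLaw μ τ)
  set G := {ω : Fin K × Fin B → _ | ∀ i, 2 * (Finset.univ.filter fun k =>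
        ε < |batchMean μ (O i) ω k - (O i * τ).trace.re|).card < K}
  have hbad : P Gᶜ ≤ ENNReal.ofReal δ := by
    have hsub : Gᶜ ⊆ ⋃ i ∈ (Finset.univ : Finset (Fin M)), {ω | K ≤ 2 * (Finset.univ.filter fun k =>
        ε < |batchMean μ (O i) ω k - (O i * τ).trace.re|).card} := by
      intro ω hω
      simpa [G] using hω
    refine (measure_mono hsub).trans ((measure_biUnion_finset_le _ _).trans ?_)
    rcases Nat.eq_zero_or_pos M with rfl | hM
    · simp
    have hM' : (0 : ℝ) < M := by exact_mod_cast hM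
    have hone : ∀ i, P {ω | K ≤ 2 * (Finset.univ.filter fun k =>
        ε < |batchMean μ (O i) ω k - (O i * τ).trace.re|).card} ≤
          ENNReal.ofReal (δ / (2 * M)) := by
      intro i
      have h1 := pi_half_batches_bad_le (shotLaw μ τ) (measurable_trace_mul_classicalShadow h (O i))
        (memLp_trace_mul_classicalShadow h hτ (O i)) (c := c i) (V := V) (ε := ε)
        (by rw [integral_sq_trace_mul_classicalShadow_sub h hτ]; exact hV i) hε hB hBV K
      rw [integral_trace_mul_classicalShadow h hτ] at h1
      refine h1.trans (ENNReal.ofReal_le_ofReal ?_)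
      have h2 : Real.exp (-(K / 2 : ℝ)) ≤ Real.exp (-Real.log (2 * M / δ)) :=
        Real.exp_le_exp.mpr (by linarith)
      rwa [Real.exp_neg (Real.log _), Real.exp_log (by positivity), inv_div] at h2
    refine (Finset.sum_le_sum fun i _ => hone i).trans ?_
    rw [Finset.sum_const, Finset.card_univ, Fintype.card_fin, nsmul_eq_mul,
      ← ENNReal.ofReal_natCast, ← ENNReal.ofReal_mul hM'.le]
    refine ENNReal.ofReal_le_ofReal ?_
    -- The M events contribute M · δ/(2M) = δ/2, leaving a spare factor 2.
    rw [mul_div_assoc', div_le_iff₀ (by positivity)]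
    nlinarith [mul_pos hM' hδ]
  -- Subadditivity suffices, so `G` need not be shown measurable.
  have huniv : 1 ≤ P G + P Gᶜ := by
    rw [← measure_univ (μ := P), ← Set.union_compl_self G]
    exact measure_union_le _ _
  rw [ENNReal.ofReal_sub _ hδ.le, ENNReal.ofReal_one]
  exact tsub_le_iff_right.mpr (huniv.trans (add_le_add_right hbad _))

/-- If `m` exceeded t + ε, all values ≥ m would be bad, and these are at least half of all;
symmetrically below. The argument does not depend on the median convention. -/
theorem abs_sub_le_of_isMedian {K : ℕ} {v : Fin K → ℝ} {m t : ℝ} (hm : IsMedian v m)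
    (hv : 2 * (Finset.univ.filter fun k => ε < |v k - t|).card < K) : |m - t| ≤ ε := by
  classical
  by_contra! hlt
  have key : ∀ s : Set (Fin K), (∀ k ∈ s, ε < |v k - t|) →
      s.ncard ≤ (Finset.univ.filter fun k => ε < |v k - t|).card := by
    intro s hs
    rw [← Set.ncard_coe_finset]
    exact Set.ncard_le_ncard fun k hk => by simpa using hs k hk
  rcases lt_abs.mp hlt with h | h
  · have := key {k | m ≤ v k} fun k (hk : m ≤ v k) => lt_abs.mpr (Or.inl (by linarith))
    have := hm.2
    omega
  · have := key {k | v k ≤ m} fun k (hk : v k ≤ m) => lt_abs.mpr (Or.inr (by linarith))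
    have := hm.1
    omega

theorem medianOfMeansPredicts_of_shadowMoment_le (h : TomographicallyComplete μ)
    (hV : ∀ i τ, IsDensity τ → shadowMoment μ τ (O i - (c i : ℂ) • 1) ≤ 3 * V)
    (hε : 0 < ε) (hδ : 0 < δ) {K B : ℕ} (hK : 2 * Real.log (2 * M / δ) ≤ K) (hB : 0 < B)
    (hBV : 34 / ε ^ 2 * V ≤ B) : MedianOfMeansPredicts μ O ε δ K B := by
  intro E hE
  have hτ := isDensity_choiState hE
  refine (one_sub_le_measure_batches_good h hτ (fun i => hV i _ hτ) hε hδ hK hB hBV).trans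
    (measure_mono fun ω hω i m hm => ?_)
  exact abs_sub_le_of_isMedian hm (hω i)

/-- Nonnegativity of the variance: the centred prediction has mean tr(Aτ) - a, and its second moment
is the right-hand side. A small moment therefore makes `a` itself a good estimate. -/
theorem sq_trace_mul_sub_le_shadowMoment (h : TomographicallyComplete μ)
    {τ : Op (Fin n ⊕ Fin n)} (hτ : IsDensity τ) (A : Op (Fin n ⊕ Fin n)) (a : ℝ) :
    ((A * τ).trace.re - a) ^ 2 ≤ shadowMoment μ τ (A - (a : ℂ) • 1) := by
  have hprob := isProbabilityMeasure_shotLaw (μ := μ) hτ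
  have hL := (memLp_trace_mul_classicalShadow h hτ A).sub (memLp_const a)
  have h0 := variance_nonneg
    ((fun z => (A * classicalShadow μ z).trace.re) - fun _ => a) (shotLaw μ τ)
  rw [variance_eq_sub hL] at h0
  have h1 : ∫ z, ((fun z => (A * classicalShadow μ z).trace.re) - fun _ => a : _ → ℝ) z ∂(shotLaw μ τ) =
      (A * τ).trace.re - a := by
    simp only [Pi.sub_apply]
    rw [integral_sub ((memLp_trace_mul_classicalShadow h hτ A).integrable one_le_two)
      (integrable_const a), integral_trace_mul_classicalShadow h hτ]
    simp
  rw [h1] at h0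
  simp only [Pi.pow_apply, Pi.sub_apply] at h0
  rw [integral_sq_trace_mul_classicalShadow_sub h hτ] at h0
  linarith

theorem measurementsSuffice_of_shadowMoment_le (h : TomographicallyComplete μ)
    (hV : ∀ i τ, IsDensity τ → shadowMoment μ τ (O i - (c i : ℂ) • 1) ≤ 3 * V)
    (hε : 0 < ε) (hδ : 0 < δ) (hδ1 : δ < 1) {T : ℕ}
    (hT : 148 * (Real.log (2 * M / δ) / ε ^ 2 * V) ≤ T) : MeasurementsSuffice μ O ε δ T := by
  -- In the small case the hypothesis on `T` may even allow T = 0, so no full batch is available.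
  -- The constants `c i` then serve, since (tr(O_i τ) - c_i)² ≤ 3V ≤ ε².
  rcases le_or_gt (3 * V) (ε ^ 2) with hsmall | hbig
  · refine ⟨fun _ i => c i, measurable_const, fun E hE => ?_⟩
    have hτ := isDensity_choiState hE
    have hprob := isProbabilityMeasure_shotLaw (μ := μ) hτ
    have huniv : {ω : Fin T → Unitaries (Fin n ⊕ Fin n) × Bits (Fin n ⊕ Fin n) |
        ∀ i, |c i - (O i * choiState E).trace.re| ≤ ε} = Set.univ := by
      refine Set.eq_univ_of_forall fun ω i => ?_
      rw [abs_sub_comm]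
      exact abs_le_of_sq_le_sq ((sq_trace_mul_sub_le_shadowMoment h hτ (O i) (c i)).trans
        ((hV i _ hτ).trans hsmall)) hε.le
    rw [huniv, measure_univ]
    exact ENNReal.ofReal_le_one.mpr (by linarith)
  -- For M = 0 the logarithm is log 0 = 0 by convention and the lower bound on `L` below would fail.
  rcases Nat.eq_zero_or_pos M with rfl | hM
  · refine ⟨fun _ i => i.elim0, measurable_pi_iff.mpr fun i => i.elim0, fun E hE => ?_⟩
    have hprob := isProbabilityMeasure_shotLaw (μ := μ) (isDensity_choiState hE)
    have huniv : {ω : Fin T → Unitaries (Fin n ⊕ Fin n) × Bits (Fin n ⊕ Fin n) |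
        ∀ i : Fin 0, |(i.elim0 : ℝ) - (O i * choiState E).trace.re| ≤ ε} = Set.univ :=
      Set.eq_univ_of_forall fun ω i => i.elim0
    rw [huniv, measure_univ]
    exact ENNReal.ofReal_le_one.mpr (by linarith)
  set L := Real.log (2 * M / δ)
  have hL : 1 / 2 < L :=
    lt_of_lt_of_le (by linarith [Real.log_two_gt_d9]) (log_two_mul_div_ge hM hδ hδ1)
  have hε2 : 0 < ε ^ 2 := by positivity
  have hW : 1 < 3 * (V / ε ^ 2) := by
    rw [mul_div_assoc', lt_div_iff₀ hε2]
    linarith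
  set K := ⌈2 * L⌉₊
  set B := ⌈34 / ε ^ 2 * V⌉₊
  have hK1 : 2 * L ≤ K := Nat.le_ceil _
  have hK2 : (K : ℝ) < 2 * L + 1 := Nat.ceil_lt_add_one (by linarith)
  have hBeq : 34 / ε ^ 2 * V = 34 * (V / ε ^ 2) := by ring
  have hB1 : 34 / ε ^ 2 * V ≤ B := Nat.le_ceil _
  have hB2 : (B : ℝ) < 34 / ε ^ 2 * V + 1 := Nat.ceil_lt_add_one (by rw [hBeq]; linarith)
  have hKpos : 0 < K := Nat.ceil_pos.mpr (by linarith)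
  have hBpos : 0 < B := Nat.ceil_pos.mpr (by rw [hBeq]; linarith)
  -- Rounding up costs at most constant factors: K < 2L + 1 ≤ 4L as L > 1/2, and B < 34W + 1 ≤ 37W
  -- as 3W > 1, where W = V/ε². Hence 148 = 4 · 37.
  have hKB : K * B ≤ T := by
    have h1 : (K : ℝ) * B ≤ (4 * L) * (37 * (V / ε ^ 2)) :=
      mul_le_mul (by linarith) (by linarith) (Nat.cast_nonneg _) (by linarith)
    have h2 : (4 * L) * (37 * (V / ε ^ 2)) = 148 * (L / ε ^ 2 * V) := by ring
    have h3 : ((K * B : ℕ) : ℝ) ≤ T := by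
      push_cast
      linarith
    exact_mod_cast h3
  -- The first K·B records are arranged into batches and the others are discarded.
  let f : Fin K × Fin B → Fin T := fun p => Fin.castLE hKB (finProdFinEquiv p)
  have hf : Function.Injective f := (Fin.castLE_injective hKB).comp finProdFinEquiv.injective
  obtain ⟨med, hmed, hmed'⟩ := exists_measurable_median hKpos
  have hbm : ∀ i k, Measurable fun η : Fin K × Fin B → Unitaries (Fin n ⊕ Fin n) ×
      Bits (Fin n ⊕ Fin n) => batchMean μ (O i) η k := by
    intro i k
    have : Measurable fun η : Fin K × Fin B → Unitaries (Fin n ⊕ Fin n) × Bits (Fin n ⊕ Fin n) =>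
        ∑ j, (O i * classicalShadow μ (η (k, j))).trace.re :=
      Finset.measurable_sum _ fun j _ =>
        (measurable_trace_mul_classicalShadow h (O i)).comp (measurable_pi_apply _)
    exact this.div_const _
  have hest : ∀ i, Measurable fun η : Fin K × Fin B → Unitaries (Fin n ⊕ Fin n) ×
      Bits (Fin n ⊕ Fin n) => med (batchMean μ (O i) η) := fun i =>
    hmed.comp (measurable_pi_iff.mpr (hbm i))
  have hproj : Measurable fun (ω : Fin T → Unitaries (Fin n ⊕ Fin n) × Bits (Fin n ⊕ Fin n))
      (p : Fin K × Fin B) => ω (f p) := by fun_prop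
  refine ⟨fun ω i => med (batchMean μ (O i) fun p => ω (f p)),
    measurable_pi_iff.mpr fun i => (hest i).comp hproj, fun E hE => ?_⟩
  have hτ := isDensity_choiState hE
  have hprob := isProbabilityMeasure_shotLaw (μ := μ) hτ
  have hgood := one_sub_le_measure_batches_good h hτ (fun i => hV i _ hτ) hε hδ hK1 hBpos hB1
  have hmeas : MeasurableSet {η : Fin K × Fin B → Unitaries (Fin n ⊕ Fin n) ×
      Bits (Fin n ⊕ Fin n) | ∀ i, |med (batchMean μ (O i) η) - (O i * choiState E).trace.re| ≤ ε} := by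
    rw [Set.ofPred_forall]
    exact MeasurableSet.iInter fun i =>
      measurableSet_le ((hest i).sub_const _).abs measurable_const
  have hsub := hgood.trans (measure_mono (t := {η | ∀ i,
    |med (batchMean μ (O i) η) - (O i * choiState E).trace.re| ≤ ε}) fun η hη i => hmed' _ _ _ (hη i))
  rw [← pi_map_comp_injective (shotLaw μ (choiState E)) hf, Measure.map_apply hproj hmeas] at hsub
  exact hsub

end Prediction

/-! ### Pauli matrices -/

/-- The commutation sign of two Pauli matrices. -/
def pauliSign (a b : Fin 4) : ℤ := if a = 0 ∨ b = 0 ∨ a = b then 1 else -1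

/-- The label of the product of two Pauli matrices. -/
def pauliAdd : Fin 4 → Fin 4 → Fin 4 :=
  ![![0, 1, 2, 3], ![1, 0, 3, 2], ![2, 3, 0, 1], ![3, 2, 1, 0]]

/-- The phase of the product of two Pauli matrices. -/
def pauliPhase : Fin 4 → Fin 4 → ℂ :=
  ![![1, 1, 1, 1], ![1, 1, Complex.I, -Complex.I], ![1, -Complex.I, 1, Complex.I],
    ![1, Complex.I, -Complex.I, 1]]

theorem pauli_mul (a b : Fin 4) : pauli a * pauli b = pauliPhase a b • pauli (pauliAdd a b) := by
  fin_cases a <;> fin_cases b <;> ext i j <;> fin_cases i <;> fin_cases j <;>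
    simp [pauli, pauliPhase, pauliAdd]

theorem pauli_conjTranspose (a : Fin 4) : (pauli a)ᴴ = pauli a := by
  fin_cases a <;> ext i j <;> fin_cases i <;> fin_cases j <;> simp [pauli]

theorem trace_pauli (a : Fin 4) : (pauli a).trace = if a = 0 then 2 else 0 := by
  fin_cases a <;> simp [pauli, Matrix.trace_fin_two]
  norm_num

/-- Completeness of the Pauli basis: ∑ P ⊗ P is twice the swap operator. -/
theorem sum_pauli_mul_pauli (i j k l : Fin 2) :
    ∑ a, pauli a i j * pauli a k l = if i = l ∧ j = k then 2 else 0 := by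
  fin_cases i <;> fin_cases j <;> fin_cases k <;> fin_cases l <;>
    simp [pauli, Fin.sum_univ_four] <;> norm_num

theorem pauliPhase_eq_sign_mul (a b : Fin 4) :
    pauliPhase a b = pauliSign a b * pauliPhase b a := by
  fin_cases a <;> fin_cases b <;> simp [pauliPhase, pauliSign]

/-- The phase is ±i exactly for anticommuting pairs. This later turns i P_w P_s into ± a Pauli
string. -/
theorem pauliPhase_sq (a b : Fin 4) : pauliPhase a b ^ 2 = pauliSign a b := by
  fin_cases a <;> fin_cases b <;> simp [pauliPhase, pauliSign]

theorem pauliPhase_self (a : Fin 4) : pauliPhase a a = 1 := by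
  fin_cases a <;> simp [pauliPhase]

theorem pauliAdd_comm : ∀ a b, pauliAdd a b = pauliAdd b a := by decide

theorem pauliAdd_self : ∀ a, pauliAdd a a = 0 := by decide

theorem pauliAdd_zero : ∀ a, pauliAdd a 0 = a := by decide

theorem pauliAdd_eq_zero : ∀ a b, pauliAdd a b = 0 → a = b := by decide

theorem pauliAdd_assoc : ∀ a b c, pauliAdd (pauliAdd a b) c = pauliAdd a (pauliAdd b c) := by decide

theorem pauliSign_add : ∀ a b c, pauliSign (pauliAdd a b) c = pauliSign a c * pauliSign b c := by
  decide

theorem pauliSign_comm : ∀ a b, pauliSign a b = pauliSign b a := by decide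

theorem pauliSign_zero : ∀ a, pauliSign a 0 = 1 := by decide

theorem pauliSign_eq : ∀ a b, pauliSign a b = 1 ∨ pauliSign a b = -1 := by decide

theorem exists_pauliSign_eq_neg_one : ∀ a, a ≠ 0 → ∃ b, pauliSign a b = -1 := by decide

/-! ### Tensor products of single-qubit operators -/

section QubitProd

variable {ι : Type} [Fintype ι]

/-- The tensor product of single-qubit operators. -/
def qubitProd (m : ι → Matrix (Fin 2) (Fin 2) ℂ) : Op ι :=
  Matrix.of fun x y => ∏ q, m q (x q) (y q)

theorem qubitProd_mul [DecidableEq ι] (m k : ι → Matrix (Fin 2) (Fin 2) ℂ) :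
    qubitProd m * qubitProd k = qubitProd fun q => m q * k q := by
  ext x y
  simp only [qubitProd, Matrix.mul_apply, Matrix.of_apply]
  rw [Finset.prod_univ_sum, Fintype.piFinset_univ]
  exact Finset.sum_congr rfl fun z _ => Finset.prod_mul_distrib.symm

theorem qubitProd_smul (c : ι → ℂ) (m : ι → Matrix (Fin 2) (Fin 2) ℂ) :
    (qubitProd fun q => c q • m q) = (∏ q, c q) • qubitProd m := by
  ext x y
  simp [qubitProd, Finset.prod_mul_distrib]

theorem qubitProd_conjTranspose (m : ι → Matrix (Fin 2) (Fin 2) ℂ) :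
    (qubitProd m)ᴴ = qubitProd fun q => (m q)ᴴ := by
  ext x y
  simp [qubitProd]

theorem trace_qubitProd [DecidableEq ι] (m : ι → Matrix (Fin 2) (Fin 2) ℂ) :
    (qubitProd m).trace = ∏ q, (m q).trace := by
  simp only [qubitProd, Matrix.trace, Matrix.diag, Matrix.of_apply]
  rw [Finset.prod_univ_sum, Fintype.piFinset_univ]

end QubitProd

/-! ### Pauli strings -/

section PauliString

variable {ι : Type}

/-- The label of the product of two Pauli strings. -/
def stringAdd (s t : ι → Fin 4) : ι → Fin 4 := fun q => pauliAdd (s q) (t q)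

theorem stringAdd_comm (s t : ι → Fin 4) : stringAdd s t = stringAdd t s :=
  funext fun _ => pauliAdd_comm _ _

theorem stringAdd_self (s : ι → Fin 4) : stringAdd s s = 0 :=
  funext fun _ => pauliAdd_self _

theorem stringAdd_zero (s : ι → Fin 4) : stringAdd s 0 = s :=
  funext fun _ => pauliAdd_zero _

theorem stringAdd_assoc (s t u : ι → Fin 4) :
    stringAdd (stringAdd s t) u = stringAdd s (stringAdd t u) :=
  funext fun _ => pauliAdd_assoc _ _ _

theorem eq_of_stringAdd_eq_zero {s t : ι → Fin 4} (h : stringAdd s t = 0) : s = t :=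
  funext fun q => pauliAdd_eq_zero _ _ (congrFun h q)

variable [Fintype ι]

theorem pauliString_eq_qubitProd (s : ι → Fin 4) :
    pauliString s = qubitProd fun q => pauli (s q) := rfl

theorem pauliString_conjTranspose (s : ι → Fin 4) : (pauliString s)ᴴ = pauliString s := by
  simp only [pauliString_eq_qubitProd, qubitProd_conjTranspose, pauli_conjTranspose]

theorem pauliString_zero : pauliString (0 : ι → Fin 4) = 1 := by
  ext x y
  simp only [pauliString, Matrix.of_apply, Pi.zero_apply]
  have h : pauli 0 = 1 := by
    ext i j
    fin_cases i <;> fin_cases j <;> simp [pauli]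
  rw [h]
  by_cases hxy : x = y
  · subst hxy
    rw [Matrix.one_apply_eq]
    exact Finset.prod_eq_one fun q _ => Matrix.one_apply_eq _
  · obtain ⟨q, hq⟩ := Function.ne_iff.mp hxy
    rw [Matrix.one_apply_ne hxy]
    exact Finset.prod_eq_zero (Finset.mem_univ q) (Matrix.one_apply_ne hq)

/-- The commutation sign of two Pauli strings. -/
def stringSign (s t : ι → Fin 4) : ℤ := ∏ q, pauliSign (s q) (t q)

/-- The phase of the product of two Pauli strings. -/
def stringPhase (s t : ι → Fin 4) : ℂ := ∏ q, pauliPhase (s q) (t q)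

theorem stringPhase_eq_sign_mul (s t : ι → Fin 4) :
    stringPhase s t = stringSign s t * stringPhase t s := by
  simp only [stringPhase, stringSign, Int.cast_prod, ← Finset.prod_mul_distrib]
  exact Finset.prod_congr rfl fun q _ => pauliPhase_eq_sign_mul _ _

theorem stringPhase_sq (s t : ι → Fin 4) : stringPhase s t ^ 2 = stringSign s t := by
  simp only [stringPhase, stringSign, Int.cast_prod, ← Finset.prod_pow]
  exact Finset.prod_congr rfl fun q _ => pauliPhase_sq _ _

theorem stringPhase_self (s : ι → Fin 4) : stringPhase s s = 1 :=
  Finset.prod_eq_one fun _ _ => pauliPhase_self _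

theorem stringSign_add (s t u : ι → Fin 4) :
    stringSign (stringAdd s t) u = stringSign s u * stringSign t u := by
  simp only [stringSign, stringAdd, ← Finset.prod_mul_distrib]
  exact Finset.prod_congr rfl fun q _ => pauliSign_add _ _ _

theorem stringSign_comm (s t : ι → Fin 4) : stringSign s t = stringSign t s :=
  Finset.prod_congr rfl fun _ _ => pauliSign_comm _ _

theorem stringSign_zero (s : ι → Fin 4) : stringSign s 0 = 1 :=
  Finset.prod_eq_one fun _ _ => pauliSign_zero _

theorem stringSign_eq (s t : ι → Fin 4) : stringSign s t = 1 ∨ stringSign s t = -1 := by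
  refine Finset.prod_induction _ (fun z => z = 1 ∨ z = -1) ?_ (Or.inl rfl)
    fun q _ => pauliSign_eq _ _
  rintro a b (rfl | rfl) (rfl | rfl) <;> simp

theorem stringSign_self (s : ι → Fin 4) : stringSign s s = 1 :=
  Finset.prod_eq_one fun q _ => by simp [pauliSign]

theorem exists_stringSign_eq_neg_one [DecidableEq ι] {s : ι → Fin 4} (hs : s ≠ 0) :
    ∃ r, stringSign s r = -1 := by
  obtain ⟨q, hq⟩ := Function.ne_iff.mp hs
  obtain ⟨b, hb⟩ := exists_pauliSign_eq_neg_one (s q) hq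
  refine ⟨Function.update 0 q b, ?_⟩
  rw [stringSign, Finset.prod_eq_single q]
  · simpa using hb
  · intro r _ hr
    simp [Function.update_of_ne hr, pauliSign_zero]
  · simp

variable [DecidableEq ι]

theorem pauliString_mul (s t : ι → Fin 4) :
    pauliString s * pauliString t = stringPhase s t • pauliString (stringAdd s t) := by
  simp only [pauliString_eq_qubitProd, qubitProd_mul, pauli_mul, qubitProd_smul, stringPhase,
    stringAdd]

theorem pauliString_mul_comm (s t : ι → Fin 4) :
    pauliString s * pauliString t = (stringSign s t : ℂ) • (pauliString t * pauliString s) := by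
  rw [pauliString_mul, pauliString_mul, stringAdd_comm, stringPhase_eq_sign_mul, smul_smul]

theorem pauliString_mul_self (s : ι → Fin 4) : pauliString s * pauliString s = 1 := by
  rw [pauliString_mul, stringPhase_self, stringAdd_self, pauliString_zero, one_smul]

theorem trace_pauliString (s : ι → Fin 4) :
    (pauliString s).trace = if s = 0 then 2 ^ Fintype.card ι else 0 := by
  rw [pauliString_eq_qubitProd, trace_qubitProd]
  simp_rw [trace_pauli]
  split_ifs with h
  · simp [h]
  · obtain ⟨q, hq⟩ := Function.ne_iff.mp h
    exact Finset.prod_eq_zero (Finset.mem_univ q) (if_neg hq)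

theorem trace_pauliString_mul (s t : ι → Fin 4) :
    (pauliString s * pauliString t).trace = if s = t then 2 ^ Fintype.card ι else 0 := by
  rw [pauliString_mul, Matrix.trace_smul, trace_pauliString]
  by_cases h : s = t
  · subst h
    simp [stringAdd_self, stringPhase_self]
  · have : stringAdd s t ≠ 0 := fun h0 => h (eq_of_stringAdd_eq_zero h0)
    simp [h, this]

/-- The coefficient of a Pauli string in the expansion of an operator. -/
def pauliCoeff (A : Op ι) (s : ι → Fin 4) : ℂ :=
  ((2 : ℂ) ^ Fintype.card ι)⁻¹ * (pauliString s * A).trace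

/-- The single-qubit completeness relation, multiplied over the qubits. -/
theorem sum_pauliCoeff_smul (A : Op ι) : ∑ s, pauliCoeff A s • pauliString s = A := by
  ext x y
  simp only [Matrix.sum_apply, Matrix.smul_apply, smul_eq_mul, pauliCoeff, Matrix.trace,
    Matrix.diag, Matrix.mul_apply, Finset.mul_sum, Finset.sum_mul]
  have key : ∀ i j : Bits ι, ∑ s : ι → Fin 4, pauliString s i j * pauliString s x y =
      if i = y ∧ j = x then 2 ^ Fintype.card ι else 0 := by
    intro i j
    simp only [pauliString, Matrix.of_apply, ← Finset.prod_mul_distrib]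
    have := Finset.prod_univ_sum (fun _ : ι => (Finset.univ : Finset (Fin 4)))
      fun q a => pauli a (i q) (j q) * pauli a (x q) (y q)
    rw [Fintype.piFinset_univ] at this
    rw [← this]
    simp_rw [sum_pauli_mul_pauli]
    split_ifs with h
    · simp [h.1, h.2]
    · rw [not_and_or] at h
      rcases h with h | h
      all_goals
        obtain ⟨q, hq⟩ := Function.ne_iff.mp h
        exact Finset.prod_eq_zero (Finset.mem_univ q) (by simp [hq])
  rw [Finset.sum_comm]
  have hi : ∀ i : Bits ι, ∑ s : ι → Fin 4, ∑ j : Bits ι,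
      ((2 : ℂ) ^ Fintype.card ι)⁻¹ * (pauliString s i j * A j i) * pauliString s x y =
      if i = y then A x i else 0 := by
    intro i
    rw [Finset.sum_comm]
    have hj : ∀ j : Bits ι, ∑ s : ι → Fin 4,
        ((2 : ℂ) ^ Fintype.card ι)⁻¹ * (pauliString s i j * A j i) * pauliString s x y =
        if i = y ∧ j = x then A j i else 0 := by
      intro j
      have : ∀ s : ι → Fin 4,
          ((2 : ℂ) ^ Fintype.card ι)⁻¹ * (pauliString s i j * A j i) * pauliString s x y =
          ((2 : ℂ) ^ Fintype.card ι)⁻¹ * A j i * (pauliString s i j * pauliString s x y) :=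
        fun s => by ring
      simp_rw [this]
      rw [← Finset.mul_sum, key]
      split_ifs
      · field_simp
      · simp
    simp_rw [hj]
    by_cases h : i = y <;> simp [h]
  simp_rw [hi]
  simp

theorem pauliCoeff_im {A : Op ι} (hA : A.IsHermitian) (s : ι → Fin 4) :
    (pauliCoeff A s).im = 0 := by
  rw [← Complex.conj_eq_iff_im]
  have h : star (pauliString s * A).trace = (pauliString s * A).trace := by
    rw [← Matrix.trace_conjTranspose, Matrix.conjTranspose_mul, pauliString_conjTranspose, hA.eq,
      Matrix.trace_mul_comm]
  have h' : (starRingEnd ℂ) (pauliString s * A).trace = (pauliString s * A).trace := h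
  rw [pauliCoeff, map_mul, h', map_inv₀, map_pow, map_ofNat]

theorem sum_re_pauliCoeff_smul {A : Op ι} (hA : A.IsHermitian) :
    ∑ s, ((pauliCoeff A s).re : ℂ) • pauliString s = A := by
  conv_rhs => rw [← sum_pauliCoeff_smul A]
  refine Finset.sum_congr rfl fun s _ => ?_
  congr 1
  exact Complex.ext (by simp) (by simp [pauliCoeff_im hA])

/-- Parseval's identity for the orthogonal basis of Pauli strings; a Hermitian operator has real
coefficients. -/
theorem sum_sq_re_pauliCoeff {A : Op ι} (hA : A.IsHermitian) :
    2 ^ Fintype.card ι * ∑ s, (pauliCoeff A s).re ^ 2 = (A * A).trace.re := by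
  conv_rhs => rw [← sum_re_pauliCoeff_smul hA]
  simp only [Finset.sum_mul_sum, smul_mul_smul_comm, Matrix.trace_sum, Matrix.trace_smul,
    trace_pauliString_mul, smul_eq_mul]
  simp only [mul_ite, mul_zero, Finset.sum_ite_eq, Finset.mem_univ, if_true]
  rw [Complex.re_sum, Finset.mul_sum]
  refine Finset.sum_congr rfl fun s _ => ?_
  have : ((pauliCoeff A s).re : ℂ) * (pauliCoeff A s).re * 2 ^ Fintype.card ι =
      (((pauliCoeff A s).re * (pauliCoeff A s).re * 2 ^ Fintype.card ι : ℝ) : ℂ) := by push_cast; rfl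
  rw [this, Complex.ofReal_re]
  ring

end PauliString

theorem pauli_diagonal_or (a : Fin 4) :
    (∀ i, pauli a i i = 0) ∨
      ((∀ i j, i ≠ j → pauli a i j = 0) ∧ ∀ i, pauli a i i = 1 ∨ pauli a i i = -1) := by
  fin_cases a
  · right; simp [pauli, Fin.forall_fin_two]
  · left; simp [pauli, Fin.forall_fin_two]
  · left; simp [pauli, Fin.forall_fin_two]
  · right; simp [pauli, Fin.forall_fin_two]

/-- A Pauli string either has zero diagonal or is diagonal with entries `±1`. -/
theorem pauliString_diagonal_or {ι : Type} [Fintype ι] (t : ι → Fin 4) :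
    (∀ b, pauliString t b b = 0) ∨
      ∃ d : Bits ι → ℝ, (∀ b, d b ^ 2 = 1) ∧
        pauliString t = Matrix.diagonal fun b => (d b : ℂ) := by
  by_cases h : ∃ q, ∀ i, pauli (t q) i i = 0
  · obtain ⟨q, hq⟩ := h
    exact Or.inl fun b => Finset.prod_eq_zero (Finset.mem_univ q) (hq _)
  · push Not at h
    have h' := fun q => (pauli_diagonal_or (t q)).resolve_left (not_forall.mpr (h q))
    refine Or.inr ⟨fun b => ∏ q, (pauli (t q) (b q) (b q)).re, fun b => ?_, ?_⟩
    · rw [← Finset.prod_pow]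
      refine Finset.prod_eq_one fun q _ => ?_
      rcases (h' q).2 (b q) with hq | hq <;> simp [hq]
    · ext x y
      by_cases hxy : x = y
      · subst hxy
        rw [Matrix.diagonal_apply_eq, Complex.ofReal_prod]
        refine Finset.prod_congr rfl fun q _ => ?_
        rcases (h' q).2 (x q) with hq | hq <;> simp [hq]
      · obtain ⟨q, hq⟩ := Function.ne_iff.mp hxy
        rw [Matrix.diagonal_apply_ne _ hxy]
        exact Finset.prod_eq_zero (Finset.mem_univ q) ((h' q).1 _ _ hq)

/-! ### Clifford measurement primitives, diagonalized in the Pauli basis. -/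

section Clifford

variable {ι : Type} [Fintype ι] [DecidableEq ι]

/-- Conjugation by `U` maps Pauli strings to Pauli strings up to sign. -/
def IsClifford (U : Unitaries ι) : Prop :=
  ∀ s : ι → Fin 4, ∃ t : ι → Fin 4,
    (U : Op ι) * pauliString s * (U : Op ι)ᴴ = pauliString t ∨
    (U : Op ι) * pauliString s * (U : Op ι)ᴴ = -pauliString t

/-- For a Clifford unitary, this is `1` if it maps the Pauli string `s` to a diagonal one and `0`
otherwise. -/
def zIndicator (U : Unitaries ι) (s : ι → Fin 4) : ℝ :=
  (diagEntry U (fun _ => 0) (pauliString s)).re ^ 2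

/-- The image of the string is ± a Pauli string, whose diagonal is either zero or made of ±1. One
diagonal entry therefore decides between the two, which is why `zIndicator` looks only at the
outcome 0. -/
theorem zIndicator_cases {U : Unitaries ι} (hU : IsClifford U) (s : ι → Fin 4) :
    (zIndicator U s = 0 ∧ ∀ b, diagEntry U b (pauliString s) = 0) ∨
      (zIndicator U s = 1 ∧ ∃ d : Bits ι → ℝ, (∀ b, diagEntry U b (pauliString s) = d b) ∧
        pauliString s = (U : Op ι)ᴴ * Matrix.diagonal (fun b => (d b : ℂ)) * (U : Op ι)) := by
  have hconj : ∀ A B : Op ι, (U : Op ι) * A * (U : Op ι)ᴴ = B →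
      A = (U : Op ι)ᴴ * B * (U : Op ι) := by
    rintro A B rfl
    simp only [← mul_assoc, unitary_conjTranspose_mul, one_mul]
    rw [mul_assoc, unitary_conjTranspose_mul, mul_one]
  obtain ⟨t, ht⟩ := hU s
  rcases pauliString_diagonal_or t with h0 | ⟨d, hd, hdiag⟩
  · have h : ∀ b, diagEntry U b (pauliString s) = 0 := by
      intro b
      rcases ht with ht | ht <;> simp [diagEntry, ht, h0]
    exact Or.inl ⟨by simp [zIndicator, h], h⟩
  · right
    obtain ⟨d', hd', hU'⟩ : ∃ d' : Bits ι → ℝ, (∀ b, d' b ^ 2 = 1) ∧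
        (U : Op ι) * pauliString s * (U : Op ι)ᴴ = Matrix.diagonal fun b => (d' b : ℂ) := by
      rcases ht with ht | ht
      · exact ⟨d, hd, ht.trans hdiag⟩
      · refine ⟨fun b => -d b, fun b => by rw [neg_sq, hd], ?_⟩
        rw [ht, hdiag, Matrix.diagonal_neg]
        congr 1
        ext b
        simp
    have hb : ∀ b, diagEntry U b (pauliString s) = d' b := fun b => by simp [diagEntry, hU']
    exact ⟨by simp [zIndicator, hb, hd'], d', hb, hconj _ _ hU'⟩

theorem zIndicator_mul_self {U : Unitaries ι} (hU : IsClifford U) (s : ι → Fin 4) :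
    zIndicator U s * zIndicator U s = zIndicator U s := by
  rcases zIndicator_cases hU s with h | h <;> simp [h.1]

theorem zIndicator_zero (U : Unitaries ι) : zIndicator U 0 = 1 := by
  simp [zIndicator, pauliString_zero, diagEntry_one]

/-- Two strings diagonalized by the same unitary commute; if they also anticommuted, their product
would vanish, although it is invertible. -/
theorem zIndicator_mul_eq_zero {U : Unitaries ι} (hU : IsClifford U) {s t : ι → Fin 4}
    (hst : stringSign s t = -1) : zIndicator U s * zIndicator U t = 0 := by
  rcases zIndicator_cases hU s with hs | ⟨_, d, _, hs⟩
  · rw [hs.1, zero_mul]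
  rcases zIndicator_cases hU t with ht | ⟨_, e, _, ht⟩
  · rw [ht.1, mul_zero]
  exfalso
  have hmul : ∀ d e : Bits ι → ℝ,
      ((U : Op ι)ᴴ * Matrix.diagonal (fun b => (d b : ℂ)) * (U : Op ι)) *
        ((U : Op ι)ᴴ * Matrix.diagonal (fun b => (e b : ℂ)) * (U : Op ι)) =
      (U : Op ι)ᴴ * Matrix.diagonal (fun b => (d b : ℂ) * e b) * (U : Op ι) := by
    intro d e
    rw [← Matrix.diagonal_mul_diagonal]
    simp only [mul_assoc]
    rw [← mul_assoc (U : Op ι) (U : Op ι)ᴴ, unitary_mul_conjTranspose, one_mul]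
  have h1 : pauliString s * pauliString t = pauliString t * pauliString s := by
    rw [hs, ht, hmul, hmul]
    simp_rw [mul_comm]
  have h2 := pauliString_mul_comm s t
  rw [hst, ← h1] at h2
  have h3 : pauliString s * pauliString t = 0 := by
    have h5 : (2 : ℂ) • (pauliString s * pauliString t) = 0 := by
      rw [two_smul]
      nth_rewrite 1 [h2]
      simp
    exact (smul_eq_zero.mp h5).resolve_left two_ne_zero
  have h4 : pauliString s * pauliString t * (pauliString t * pauliString s) = 1 := by
    rw [mul_assoc, ← mul_assoc (pauliString t), pauliString_mul_self, one_mul,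
      pauliString_mul_self]
  rw [h3, zero_mul] at h4
  exact zero_ne_one h4

theorem snapshot_conjTranspose (U : Unitaries ι) (b : Bits ι) :
    (snapshot U b)ᴴ = snapshot U b := by
  ext x y
  simp [snapshot_apply, mul_comm]

theorem snapshot_mul_self (U : Unitaries ι) (b : Bits ι) :
    snapshot U b * snapshot U b = snapshot U b := by
  simp only [snapshot, mul_assoc]
  rw [← mul_assoc (U : Op ι) (U : Op ι)ᴴ, unitary_mul_conjTranspose, one_mul,
    ← mul_assoc (Matrix.single b b (1 : ℂ))]
  simp

/-- Parseval for the rank-one projector U†|0⟩⟨0|U, whose purity is 1. Averaging gives the sum rules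
that determine `zProb` and `zProbPair` without counting Clifford unitaries. -/
theorem sum_zIndicator (U : Unitaries ι) :
    ∑ s : ι → Fin 4, zIndicator U s = 2 ^ Fintype.card ι := by
  have hH : (snapshot U fun _ => 0).IsHermitian := snapshot_conjTranspose U _
  have h := sum_sq_re_pauliCoeff hH
  have htr : (snapshot U fun _ => 0).trace = 1 := by
    rw [← one_mul (snapshot U fun _ => 0), ← diagEntry_eq_trace, diagEntry_one]
  rw [snapshot_mul_self, htr, Complex.one_re] at h
  have hc : ∀ s : ι → Fin 4, (pauliCoeff (snapshot U fun _ => 0) s).re =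
      ((2 : ℝ) ^ Fintype.card ι)⁻¹ * (diagEntry U (fun _ => 0) (pauliString s)).re := by
    intro s
    rw [pauliCoeff, ← diagEntry_eq_trace]
    have : ((2 : ℂ) ^ Fintype.card ι)⁻¹ = ((((2 : ℝ) ^ Fintype.card ι)⁻¹ : ℝ) : ℂ) := by
      push_cast; rfl
    rw [this, Complex.re_ofReal_mul]
  simp_rw [hc, mul_pow, ← Finset.mul_sum] at h
  have h2 : (2 : ℝ) ^ Fintype.card ι ≠ 0 := by positivity
  change _ * (_ * ∑ s : ι → Fin 4, zIndicator U s) = 1 at h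
  field_simp at h
  linarith

theorem boundedMeasurable_zIndicator (s : ι → Fin 4) :
    BoundedMeasurable fun U : Unitaries ι => (zIndicator U s : ℂ) := by
  have := (boundedMeasurable_diagEntry (fun _ => 0) (pauliString s)).ofReal_re.pow 2
  simpa [zIndicator] using this

theorem sum_diagEntry_smul_snapshot (U : Unitaries ι) (d : Bits ι → ℂ) :
    ∑ b, d b • snapshot U b = (U : Op ι)ᴴ * Matrix.diagonal d * (U : Op ι) := by
  have h : Matrix.diagonal d = ∑ b, d b • Matrix.single b b (1 : ℂ) := by
    ext x y
    simp [Matrix.sum_apply, Matrix.diagonal_apply, Matrix.single_apply, ite_and]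
  rw [h, Finset.mul_sum, Finset.sum_mul]
  simp only [snapshot, Matrix.mul_smul, Matrix.smul_mul]

theorem sum_diagEntry_smul_snapshot_pauliString {U : Unitaries ι} (hU : IsClifford U)
    (s : ι → Fin 4) : ∑ b, diagEntry U b (pauliString s) • snapshot U b =
      (zIndicator U s : ℂ) • pauliString s := by
  rcases zIndicator_cases hU s with ⟨h1, h2⟩ | ⟨h1, d, h2, h3⟩
  · simp [h1, h2]
  · rw [h1, Complex.ofReal_one, one_smul, sum_diagEntry_smul_snapshot]
    conv_rhs => rw [h3]
    simp_rw [h2]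

/-- The probability that the Pauli string `s` becomes diagonal. -/
def zProb (μ : Measure (Unitaries ι)) (s : ι → Fin 4) : ℝ := ∫ U, zIndicator U s ∂μ

/-- The probability that the Pauli strings `s` and `t` both become diagonal. -/
def zProbPair (μ : Measure (Unitaries ι)) (s t : ι → Fin 4) : ℝ :=
  ∫ U, zIndicator U s * zIndicator U t ∂μ

variable {μ : Measure (Unitaries ι)}

theorem zProbPair_comm (s t : ι → Fin 4) : zProbPair μ s t = zProbPair μ t s := by
  simp only [zProbPair, mul_comm]

theorem zProbPair_zero (s : ι → Fin 4) : zProbPair μ s 0 = zProb μ s := by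
  simp [zProbPair, zProb, zIndicator_zero]

theorem zProbPair_self (h : ∀ᵐ U ∂μ, IsClifford U) (s : ι → Fin 4) :
    zProbPair μ s s = zProb μ s :=
  integral_congr_ae (h.mono fun _ hU => zIndicator_mul_self hU s)

theorem zProbPair_eq_zero (h : ∀ᵐ U ∂μ, IsClifford U) {s t : ι → Fin 4}
    (hst : stringSign s t = -1) : zProbPair μ s t = 0 := by
  rw [zProbPair, integral_congr_ae (h.mono fun _ hU => zIndicator_mul_eq_zero hU hst)]
  simp

theorem zProbPair_nonneg (s t : ι → Fin 4) : 0 ≤ zProbPair μ s t :=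
  integral_nonneg fun _ => mul_nonneg (sq_nonneg _) (sq_nonneg _)

/-- Measuring in the rotated basis keeps a string that becomes diagonal and kills every other one,
so each string is an eigenvector. -/
theorem measurementChannel_pauliString (h : ∀ᵐ U ∂μ, IsClifford U) (s : ι → Fin 4) :
    measurementChannel μ (pauliString s) = (zProb μ s : ℂ) • pauliString s := by
  ext x y
  simp only [measurementChannel, Matrix.of_apply, Matrix.smul_apply, smul_eq_mul]
  have : ∀ᵐ U ∂μ, ∑ b, diagEntry U b (pauliString s) * snapshot U b x y =
      (zIndicator U s : ℂ) * pauliString s x y := by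
    filter_upwards [h] with U hU
    have := congrFun (congrFun (sum_diagEntry_smul_snapshot_pauliString hU s) x) y
    simpa [Matrix.sum_apply] using this
  rw [integral_congr_ae this, integral_mul_const, integral_complex_ofReal]
  rfl

variable [IsProbabilityMeasure μ]

theorem integrable_zIndicator (s : ι → Fin 4) : Integrable (fun U => zIndicator U s) μ := by
  simpa using ((boundedMeasurable_zIndicator s).integrable μ).re

theorem integrable_zIndicator_mul (s t : ι → Fin 4) :
    Integrable (fun U => zIndicator U s * zIndicator U t) μ := by
  simpa using (((boundedMeasurable_zIndicator s).mul (boundedMeasurable_zIndicator t)).integrable μ).re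

theorem zProb_zero : zProb μ 0 = 1 := by
  simp [zProb, zIndicator_zero]

theorem sum_zProb : ∑ s, zProb μ s = 2 ^ Fintype.card ι := by
  simp only [zProb]
  rw [← integral_finsetSum _ fun s _ => integrable_zIndicator s]
  simp_rw [sum_zIndicator]
  simp

theorem sum_zProbPair (s : ι → Fin 4) :
    ∑ t, zProbPair μ s t = 2 ^ Fintype.card ι * zProb μ s := by
  simp only [zProbPair, zProb]
  rw [← integral_finsetSum _ fun t _ => integrable_zIndicator_mul s t]
  simp_rw [← Finset.mul_sum, sum_zIndicator, integral_mul_const]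
  ring

theorem measurementChannel_sum_pauliString (h : ∀ᵐ U ∂μ, IsClifford U)
    (α : (ι → Fin 4) → ℂ) : measurementChannel μ (∑ s, α s • pauliString s) =
      ∑ s, (α s * zProb μ s) • pauliString s := by
  have : measurementLinear μ (∑ s, α s • pauliString s) =
      ∑ s, (α s * zProb μ s) • pauliString s := by
    simp only [map_sum, map_smul]
    refine Finset.sum_congr rfl fun s _ => ?_
    rw [mul_smul]
    exact congrArg _ (measurementChannel_pauliString h s)
  exact this

theorem tomographicallyComplete_of_zProb (h : ∀ᵐ U ∂μ, IsClifford U) (h0 : ∀ s, zProb μ s ≠ 0) :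
    TomographicallyComplete μ := by
  have hsurj : Function.Surjective (measurementLinear μ) := by
    intro A
    refine ⟨∑ s, (pauliCoeff A s / zProb μ s) • pauliString s, ?_⟩
    refine (measurementChannel_sum_pauliString h _).trans ?_
    conv_rhs => rw [← sum_pauliCoeff_smul A]
    refine Finset.sum_congr rfl fun s _ => ?_
    rw [div_mul_cancel₀ _ (by exact_mod_cast h0 s)]
  exact ⟨LinearMap.injective_iff_surjective.mpr hsurj, hsurj⟩

theorem inverseChannel_eq_sum (h : ∀ᵐ U ∂μ, IsClifford U) (h0 : ∀ s, zProb μ s ≠ 0)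
    {A : Op ι} (hA : A.IsHermitian) : inverseChannel μ A =
      ∑ s, (((pauliCoeff A s).re / zProb μ s : ℝ) : ℂ) • pauliString s := by
  refine inverseChannel_eq_of (tomographicallyComplete_of_zProb h h0) ?_
  rw [measurementChannel_sum_pauliString h]
  conv_rhs => rw [← sum_re_pauliCoeff_smul hA]
  refine Finset.sum_congr rfl fun s _ => ?_
  rw [← Complex.ofReal_mul, div_mul_cancel₀ _ (h0 s)]

/-- When both strings become diagonal, the diagonal of their product is the product of their
diagonals; otherwise both sides are 0. -/
theorem sum_diagEntry_mul_pauliString {U : Unitaries ι} (hU : IsClifford U) (τ : Op ι)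
    (s t : ι → Fin 4) :
    ∑ b, (diagEntry U b τ).re * ((diagEntry U b (pauliString s)).re *
      (diagEntry U b (pauliString t)).re) =
      zIndicator U s * zIndicator U t * (τ * (pauliString s * pauliString t)).trace.re := by
  rcases zIndicator_cases hU s with hs | ⟨h1, d, hd, hs⟩
  · simp [hs]
  rcases zIndicator_cases hU t with ht | ⟨h2, e, he, ht⟩
  · simp [ht]
  have hmul : pauliString s * pauliString t =
      ∑ b, ((d b * e b : ℝ) : ℂ) • snapshot U b := by
    rw [hs, ht, sum_diagEntry_smul_snapshot]
    have : (Matrix.diagonal fun b => ((d b * e b : ℝ) : ℂ)) =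
        Matrix.diagonal (fun b => (d b : ℂ)) * Matrix.diagonal (fun b => (e b : ℂ)) := by
      rw [Matrix.diagonal_mul_diagonal]
      simp
    rw [this]
    simp only [mul_assoc]
    rw [← mul_assoc (U : Op ι) (U : Op ι)ᴴ, unitary_mul_conjTranspose, one_mul]
  rw [hmul, h1, h2, Finset.mul_sum, Matrix.trace_sum, Complex.re_sum, one_mul, one_mul]
  refine Finset.sum_congr rfl fun b _ => ?_
  rw [hd, he, Complex.ofReal_re, Complex.ofReal_re, Matrix.mul_smul, Matrix.trace_smul,
    ← diagEntry_eq_trace, smul_eq_mul, Complex.re_ofReal_mul, mul_comm]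

/-- The shadow moment of a Clifford measurement primitive in terms of Pauli coefficients. -/
theorem shadowMoment_eq_sum (h : ∀ᵐ U ∂μ, IsClifford U) (h0 : ∀ s, zProb μ s ≠ 0) (τ : Op ι)
    {A : Op ι} (hA : A.IsHermitian) : shadowMoment μ τ A =
      ∑ s, ∑ t, ((pauliCoeff A s).re / zProb μ s * ((pauliCoeff A t).re / zProb μ t)) *
        (zProbPair μ s t * (τ * (pauliString s * pauliString t)).trace.re) := by
  rw [shadowMoment, inverseChannel_eq_sum h h0 hA]
  set β : (ι → Fin 4) → ℝ := fun s => (pauliCoeff A s).re / zProb μ s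
  have hdiag : ∀ (U : Unitaries ι) b, (diagEntry U b (∑ s, (β s : ℂ) • pauliString s)).re =
      ∑ s, β s * (diagEntry U b (pauliString s)).re := by
    intro U b
    rw [diagEntry_eq_trace, Finset.sum_mul, Matrix.trace_sum, Complex.re_sum]
    refine Finset.sum_congr rfl fun s _ => ?_
    rw [Matrix.smul_mul, Matrix.trace_smul, ← diagEntry_eq_trace, smul_eq_mul,
      Complex.re_ofReal_mul]
  have hpt : ∀ᵐ U ∂μ, ∑ b, (diagEntry U b τ).re *
      (diagEntry U b (∑ s, (β s : ℂ) • pauliString s)).re ^ 2 =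
      ∑ s, ∑ t, (β s * β t) * (zIndicator U s * zIndicator U t *
        (τ * (pauliString s * pauliString t)).trace.re) := by
    filter_upwards [h] with U hU
    simp_rw [← sum_diagEntry_mul_pauliString hU, hdiag, sq, Finset.sum_mul_sum, Finset.mul_sum]
    rw [Finset.sum_comm]
    refine Finset.sum_congr rfl fun s _ => ?_
    rw [Finset.sum_comm]
    exact Finset.sum_congr rfl fun t _ => Finset.sum_congr rfl fun b _ => by ring
  rw [integral_congr_ae hpt]
  have hint : ∀ s t, Integrable (fun U => (β s * β t) * (zIndicator U s * zIndicator U t *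
      (τ * (pauliString s * pauliString t)).trace.re)) μ := fun s t =>
    ((integrable_zIndicator_mul s t).mul_const _).const_mul _
  rw [integral_finsetSum _ fun s _ => integrable_finsetSum _ fun t _ => hint s t]
  refine Finset.sum_congr rfl fun s _ => ?_
  rw [integral_finsetSum _ fun t _ => hint s t]
  refine Finset.sum_congr rfl fun t _ => ?_
  rw [integral_const_mul, integral_mul_const]
  rfl

end Clifford

theorem card_ne_zero_of_string_ne_zero {ι : Type} [Fintype ι] {s : ι → Fin 4} (hs : s ≠ 0) : Fintype.card ι ≠ 0 := by
  obtain ⟨q, _⟩ := Function.ne_iff.mp hs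
  exact (Fintype.card_pos_iff.mpr ⟨q⟩).ne'

/-! ### The global Clifford primitive. -/

section CliffordGroup

variable {ι : Type} [Fintype ι] [DecidableEq ι]

/-! ### Trace inequalities -/

theorem trace_conjTranspose_mul_self_re (A : Op ι) :
    (Aᴴ * A).trace.re = ∑ i, ∑ j, ‖A i j‖ ^ 2 := by
  simp only [Matrix.trace, Matrix.diag, Matrix.mul_apply, Matrix.conjTranspose_apply,
    Complex.re_sum]
  rw [Finset.sum_comm]
  refine Finset.sum_congr rfl fun i _ => Finset.sum_congr rfl fun j _ => ?_
  have : star (A i j) * A i j = ((‖A i j‖ ^ 2 : ℝ) : ℂ) := by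
    rw [← Complex.normSq_eq_norm_sq, Complex.normSq_eq_conj_mul_self]
    rfl
  rw [this, Complex.ofReal_re]

open scoped MatrixOrder in
theorem exists_eq_conjTranspose_mul_self {τ : Op ι} (hτ : τ.PosSemidef) :
    ∃ C : Op ι, τ = Cᴴ * C :=
  CStarAlgebra.nonneg_iff_eq_star_mul_self.mp hτ.nonneg

theorem sum_sq_norm_mul_le (A B : Op ι) : ∑ i, ∑ j, ‖(A * B) i j‖ ^ 2 ≤
    (∑ i, ∑ j, ‖A i j‖ ^ 2) * ∑ i, ∑ j, ‖B i j‖ ^ 2 := by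
  rw [Finset.sum_comm (f := fun i j => ‖B i j‖ ^ 2), Finset.sum_mul_sum]
  refine Finset.sum_le_sum fun i _ => Finset.sum_le_sum fun j _ => ?_
  rw [Matrix.mul_apply]
  refine (pow_le_pow_left₀ (norm_nonneg _) (norm_sum_le _ _) 2).trans ?_
  simp_rw [norm_mul]
  exact Finset.sum_mul_sq_le_sq_mul_sq _ _ _

theorem trace_mul_sq_re {A C : Op ι} (hA : A.IsHermitian) :
    (Cᴴ * C * (A * A)).trace.re = ∑ i, ∑ j, ‖(C * A) i j‖ ^ 2 := by
  rw [← trace_conjTranspose_mul_self_re, Matrix.conjTranspose_mul, hA.eq, ← mul_assoc,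
    Matrix.trace_mul_comm]
  simp only [mul_assoc]

theorem trace_mul_sq_nonneg {τ A : Op ι} (hτ : IsDensity τ) (hA : A.IsHermitian) :
    0 ≤ (τ * (A * A)).trace.re := by
  obtain ⟨C, rfl⟩ := exists_eq_conjTranspose_mul_self hτ.1
  rw [trace_mul_sq_re hA]
  positivity

/-- With τ = C†C the left side is the squared Frobenius norm of CA. That norm is submultiplicative,
and that of C is 1. -/
theorem trace_mul_sq_le {τ A : Op ι} (hτ : IsDensity τ) (hA : A.IsHermitian) :
    (τ * (A * A)).trace.re ≤ (A * A).trace.re := by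
  obtain ⟨C, hC⟩ := exists_eq_conjTranspose_mul_self hτ.1
  have h1 : ∑ i, ∑ j, ‖C i j‖ ^ 2 = 1 := by
    rw [← trace_conjTranspose_mul_self_re, ← hC, hτ.2, Complex.one_re]
  have h2 : (A * A).trace.re = ∑ i, ∑ j, ‖A i j‖ ^ 2 := by
    rw [← trace_conjTranspose_mul_self_re, hA.eq]
  rw [hC, trace_mul_sq_re hA, h2]
  refine (sum_sq_norm_mul_le C A).trans ?_
  rw [h1, one_mul]

/-! ### The Clifford group -/

/-- Conjugation by P_r preserves the trace but negates P_s A. -/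
theorem trace_eq_zero_of_commute {A : Op ι} {r s : ι → Fin 4}
    (hA : pauliString r * A = A * pauliString r) (hrs : stringSign r s = -1) :
    (pauliString s * A).trace = 0 := by
  have h1 : (pauliString s * A).trace = (pauliString r * (pauliString s * A) * pauliString r).trace := by
    rw [Matrix.trace_mul_comm (pauliString r * _), ← mul_assoc, pauliString_mul_self, one_mul]
  have h2 : pauliString r * (pauliString s * A) * pauliString r = -(pauliString s * A) := by
    rw [mul_assoc, mul_assoc, ← hA, ← mul_assoc, pauliString_mul_comm r s, hrs]
    simp only [Int.cast_neg, Int.cast_one, neg_smul, one_smul, Matrix.neg_mul, mul_assoc]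
    rw [← mul_assoc (pauliString r), pauliString_mul_self, one_mul]
  rw [h2, Matrix.trace_neg] at h1
  exact self_eq_neg.mp h1

/-- Schur's lemma for the Pauli strings: every nonidentity string anticommutes with some string, so
only the identity coefficient survives. -/
theorem eq_smul_one_of_commute {A : Op ι} (hA : ∀ s, pauliString s * A = A * pauliString s) :
    ∃ c : ℂ, A = c • 1 := by
  refine ⟨pauliCoeff A 0, ?_⟩
  conv_lhs => rw [← sum_pauliCoeff_smul A]
  rw [Finset.sum_eq_single 0, pauliString_zero]
  · intro s _ hs
    obtain ⟨r, hr⟩ := exists_stringSign_eq_neg_one hs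
    rw [stringSign_comm] at hr
    simp [pauliCoeff, trace_eq_zero_of_commute (hA r) hr]
  · simp

theorem finite_setOf_pow_eq_one {m : ℕ} (hm : 0 < m) : {c : ℂ | c ^ m = 1}.Finite := by
  classical
  refine (Polynomial.nthRoots m (1 : ℂ)).toFinset.finite_toSet.subset fun c hc => ?_
  simpa [Polynomial.mem_nthRoots hm] using hc

/-- There are finitely many possible actions on Pauli strings. Two unitaries with the same action
differ by a scalar, and determinant 1 makes that scalar a root of unity. -/
theorem finite_cliffordSet : (cliffordSet ι).Finite := by
  refine Set.Finite.of_finite_fibers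
    (fun U : Unitaries ι => fun s : ι → Fin 4 => (U : Op ι) * pauliString s * (U : Op ι)ᴴ) ?_ ?_
  · refine (Set.Finite.pi' fun _ : ι → Fin 4 => ((Set.finite_range (pauliString (ι := ι))).union
      (Set.finite_range fun t : ι → Fin 4 => -pauliString t))).subset ?_
    rintro _ ⟨U, hU, rfl⟩ s
    obtain ⟨t, ht | ht⟩ := hU.2 s
    · exact Or.inl ⟨t, ht.symm⟩
    · exact Or.inr ⟨t, ht.symm⟩
  · rintro _ ⟨V, hV, rfl⟩
    have hfin : ((fun c : ℂ => c • (V : Op ι)) '' {c : ℂ | c ^ Fintype.card (Bits ι) = 1}).Finite :=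
      (finite_setOf_pow_eq_one Fintype.card_pos).image _
    refine (hfin.preimage (f := fun U : Unitaries ι => (U : Op ι))
      Subtype.val_injective.injOn).subset ?_
    rintro U ⟨hU, hUV⟩
    have hs : ∀ s : ι → Fin 4, (U : Op ι) * pauliString s * (U : Op ι)ᴴ =
        (V : Op ι) * pauliString s * (V : Op ι)ᴴ := fun s => congrFun hUV s
    obtain ⟨c, hc⟩ := eq_smul_one_of_commute (A := (V : Op ι)ᴴ * (U : Op ι)) fun s => by
      calc pauliString s * ((V : Op ι)ᴴ * (U : Op ι))
          = (V : Op ι)ᴴ * ((V : Op ι) * pauliString s * (V : Op ι)ᴴ) * (U : Op ι) := by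
            simp only [← mul_assoc, unitary_conjTranspose_mul, one_mul]
        _ = (V : Op ι)ᴴ * ((U : Op ι) * pauliString s * (U : Op ι)ᴴ) * (U : Op ι) := by rw [hs]
        _ = (V : Op ι)ᴴ * (U : Op ι) * pauliString s := by
            simp only [mul_assoc, unitary_conjTranspose_mul, mul_one]
    have hUc : (U : Op ι) = c • (V : Op ι) := by
      calc (U : Op ι) = (V : Op ι) * ((V : Op ι)ᴴ * (U : Op ι)) := by
            rw [← mul_assoc, unitary_mul_conjTranspose, one_mul]
        _ = c • (V : Op ι) := by rw [hc, Matrix.mul_smul, mul_one]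
    refine ⟨c, ?_, hUc.symm⟩
    have hdet := hU.1
    rw [hUc, Matrix.det_smul, hV.1, mul_one] at hdet
    exact hdet

theorem one_mem_cliffordSet : (1 : Unitaries ι) ∈ cliffordSet ι :=
  ⟨by simp, fun s => ⟨s, Or.inl (by simp)⟩⟩

theorem conj_mul (U V : Unitaries ι) (A : Op ι) :
    ((U * V : Unitaries ι) : Op ι) * A * ((U * V : Unitaries ι) : Op ι)ᴴ =
      (U : Op ι) * ((V : Op ι) * A * (V : Op ι)ᴴ) * (U : Op ι)ᴴ := by
  change ((U : Op ι) * (V : Op ι)) * A * ((U : Op ι) * (V : Op ι))ᴴ = _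
  rw [Matrix.conjTranspose_mul]
  simp only [mul_assoc]

theorem mul_mem_cliffordSet {U V : Unitaries ι} (hU : U ∈ cliffordSet ι)
    (hV : V ∈ cliffordSet ι) : U * V ∈ cliffordSet ι := by
  refine ⟨?_, fun s => ?_⟩
  · change ((U : Op ι) * (V : Op ι)).det = 1
    rw [Matrix.det_mul, hU.1, hV.1, one_mul]
  obtain ⟨t, ht⟩ := hV.2 s
  obtain ⟨u, hu⟩ := hU.2 t
  refine ⟨u, ?_⟩
  rw [conj_mul]
  rcases ht with ht | ht
  · rwa [ht]
  · rw [ht, Matrix.mul_neg, Matrix.neg_mul, neg_inj, neg_eq_iff_eq_neg]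
    exact hu.symm

theorem isClifford_of_mem {U : Unitaries ι} (hU : U ∈ cliffordSet ι) : IsClifford U := hU.2

instance instMeasurableSingletonClassUnitaries : MeasurableSingletonClass (Unitaries ι) where
  measurableSet_singleton U := by
    refine ⟨{(U : Op ι)}, ?_, ?_⟩
    · exact measurableSet_singleton (α := Bits ι → Bits ι → ℂ) (U : Op ι)
    · ext V
      exact ⟨fun h => Subtype.ext h, fun h => congrArg Subtype.val h⟩

instance instIsProbabilityMeasureGlobalClifford :
    IsProbabilityMeasure (globalClifford ι) :=
  isProbabilityMeasure_uniformOn finite_cliffordSet ⟨1, one_mem_cliffordSet⟩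

theorem ae_mem_cliffordSet : ∀ᵐ U ∂globalClifford ι, U ∈ cliffordSet ι := by
  have h := (uniformOn_eq_zero_iff (t := (cliffordSet ι)ᶜ) (finite_cliffordSet (ι := ι))).mpr
    (Set.inter_compl_self _)
  exact h

theorem ae_isClifford_globalClifford : ∀ᵐ U ∂globalClifford ι, IsClifford U :=
  ae_mem_cliffordSet.mono fun _ => isClifford_of_mem

theorem measurable_mul_right_unitaries (V : Unitaries ι) :
    Measurable fun U : Unitaries ι => U * V := by
  rw [measurable_comap_iff]
  refine measurable_pi_iff.mpr fun x => measurable_pi_iff.mpr fun y => ?_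
  have : Measurable fun U : Unitaries ι => ∑ z, (U : Op ι) x z * (V : Op ι) z y :=
    Finset.measurable_sum _ fun z _ => (boundedMeasurable_entry x z).1.mul_const _
  exact this

/-- The uniform measure on the Clifford group is right invariant. -/
theorem map_mul_right_globalClifford {V : Unitaries ι} (hV : V ∈ cliffordSet ι) :
    (globalClifford ι).map (fun U => U * V) = globalClifford ι := by
  have hinj : Function.Injective fun U : Unitaries ι => U * V := mul_left_injective V
  -- An injective self-map of a finite set is onto, so closure under products suffices and inverses
  -- are not needed.
  have himage : (fun U : Unitaries ι => U * V) '' cliffordSet ι = cliffordSet ι := by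
    refine Set.eq_of_subset_of_ncard_le ?_ (Set.ncard_image_of_injective _ hinj).ge
      finite_cliffordSet
    rintro _ ⟨U, hU, rfl⟩
    exact mul_mem_cliffordSet hU hV
  ext t ht
  rw [Measure.map_apply (measurable_mul_right_unitaries V) ht, globalClifford, uniformOn,
    cond_apply finite_cliffordSet.measurableSet, cond_apply finite_cliffordSet.measurableSet]
  congr 1
  rw [← Measure.count_injective_image hinj, Set.image_inter_preimage, himage]

theorem integral_mul_right_globalClifford {V : Unitaries ι} (hV : V ∈ cliffordSet ι)
    {f : Unitaries ι → ℝ} (hf : Measurable f) :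
    ∫ U, f (U * V) ∂globalClifford ι = ∫ U, f U ∂globalClifford ι := by
  conv_rhs => rw [← map_mul_right_globalClifford hV]
  rw [integral_map (measurable_mul_right_unitaries V).aemeasurable hf.aestronglyMeasurable]

theorem exists_unit_smul_det_eq_one (U : Unitaries ι) :
    ∃ V : Unitaries ι, (V : Op ι).det = 1 ∧ ∀ A : Op ι,
      (V : Op ι) * A * (V : Op ι)ᴴ = (U : Op ι) * A * (U : Op ι)ᴴ := by
  have hdet : (U : Op ι).det * star (U : Op ι).det = 1 := by
    rw [← Matrix.det_conjTranspose, ← Matrix.det_mul, unitary_mul_conjTranspose, Matrix.det_one]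
  have hcard : 0 < Fintype.card (Bits ι) := Fintype.card_pos
  obtain ⟨c, hc⟩ := IsAlgClosed.exists_pow_nat_eq (star (U : Op ι).det) hcard
  have hnorm : ‖(U : Op ι).det‖ = 1 := by
    have := congrArg norm hdet
    rw [norm_mul, norm_star, norm_one] at this
    nlinarith [norm_nonneg (U : Op ι).det]
  have hcn : ‖c‖ = 1 := by
    have := congrArg norm hc
    rw [norm_pow, norm_star, hnorm] at this
    exact (pow_eq_one_iff_of_nonneg (norm_nonneg c) hcard.ne').mp this
  have hcc : c * star c = 1 := by
    change c * (starRingEnd ℂ) c = 1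
    rw [Complex.mul_conj, Complex.normSq_eq_norm_sq, hcn]
    simp
  have hconj : ∀ A : Op ι, (c • (U : Op ι)) * A * (c • (U : Op ι))ᴴ =
      (U : Op ι) * A * (U : Op ι)ᴴ := by
    intro A
    rw [Matrix.conjTranspose_smul, Matrix.smul_mul, Matrix.smul_mul, Matrix.mul_smul, smul_smul,
      hcc, one_smul]
  refine ⟨⟨c • (U : Op ι), ?_⟩, ?_, hconj⟩
  · rw [Matrix.mem_unitaryGroup_iff]
    have := hconj 1
    rw [mul_one, mul_one, unitary_mul_conjTranspose] at this
    exact this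
  · change (c • (U : Op ι)).det = 1
    rw [Matrix.det_smul, hc, mul_comm, hdet]

/-- The Clifford unitary `(1 + i P_w) / √2`, with a phase, acts on the Pauli strings as the
transvection along `w`. -/
theorem exists_transvection (w : ι → Fin 4) : ∃ V ∈ cliffordSet ι, ∀ s : ι → Fin 4,
    (stringSign w s = 1 → (V : Op ι) * pauliString s * (V : Op ι)ᴴ = pauliString s) ∧
    (stringSign w s = -1 →
      (V : Op ι) * pauliString s * (V : Op ι)ᴴ = pauliString (stringAdd w s) ∨
      (V : Op ι) * pauliString s * (V : Op ι)ᴴ = -pauliString (stringAdd w s)) := by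
  set c : ℂ := (((Real.sqrt 2)⁻¹ : ℝ) : ℂ)
  have hc : c * c = 1 / 2 := by
    rw [← Complex.ofReal_mul, ← mul_inv, Real.mul_self_sqrt (by norm_num)]
    norm_num
  have hcs : star c = c := Complex.conj_ofReal _
  set W : Op ι := c • (1 + Complex.I • pauliString w)
  have hWs : Wᴴ = c • (1 - Complex.I • pauliString w) := by
    rw [Matrix.conjTranspose_smul, hcs, Matrix.conjTranspose_add, Matrix.conjTranspose_smul,
      pauliString_conjTranspose, Matrix.conjTranspose_one, Complex.star_def, Complex.conj_I,
      neg_smul, sub_eq_add_neg]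
  -- For A commuting with P_w the right side is A; for A anticommuting with P_w it is i P_w A.
  have hW : ∀ A : Op ι, W * A * Wᴴ = (1 / 2 : ℂ) • (A + pauliString w * A * pauliString w +
      Complex.I • (pauliString w * A - A * pauliString w)) := by
    intro A
    rw [hWs, ← hc]
    simp only [W, Matrix.smul_mul, Matrix.mul_smul, smul_smul, add_mul, mul_sub, one_mul, mul_one,
      smul_sub, smul_add]
    rw [show c * Complex.I * (c * Complex.I) = -(c * c) by linear_combination c * c * Complex.I_sq,
      show c * (c * Complex.I) = c * c * Complex.I by ring,
      show c * Complex.I * c = c * c * Complex.I by ring]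
    simp only [neg_smul]
    abel
  have hWu : W ∈ Matrix.unitaryGroup (Bits ι) ℂ := by
    rw [Matrix.mem_unitaryGroup_iff]
    have := hW 1
    simp only [mul_one, one_mul, pauliString_mul_self, sub_self, smul_zero, add_zero] at this
    rw [Matrix.star_eq_conjTranspose, this, ← two_smul ℂ (1 : Op ι), smul_smul]
    norm_num
  obtain ⟨V, hVdet, hV⟩ := exists_unit_smul_det_eq_one ⟨W, hWu⟩
  have hact : ∀ s : ι → Fin 4,
    (stringSign w s = 1 → (V : Op ι) * pauliString s * (V : Op ι)ᴴ = pauliString s) ∧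
    (stringSign w s = -1 →
      (V : Op ι) * pauliString s * (V : Op ι)ᴴ = pauliString (stringAdd w s) ∨
      (V : Op ι) * pauliString s * (V : Op ι)ᴴ = -pauliString (stringAdd w s)) := by
    intro s
    have hVs : (V : Op ι) * pauliString s * (V : Op ι)ᴴ = W * pauliString s * Wᴴ := hV _
    rw [hVs, hW]
    have hcomm := pauliString_mul_comm s w
    rw [stringSign_comm] at hcomm
    constructor
    · intro hs
      rw [hs, Int.cast_one, one_smul] at hcomm
      have h1 : pauliString w * pauliString s * pauliString w = pauliString s := by
        rw [← hcomm, mul_assoc, pauliString_mul_self, mul_one]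
      rw [h1, hcomm, sub_self, smul_zero, add_zero, ← two_smul ℂ, smul_smul]
      norm_num
    · intro hs
      rw [hs, Int.cast_neg, Int.cast_one, neg_smul, one_smul] at hcomm
      have h1 : pauliString w * pauliString s * pauliString w = -pauliString s := by
        rw [mul_assoc, hcomm, mul_neg, ← mul_assoc, pauliString_mul_self, one_mul]
      rw [h1, hcomm, sub_neg_eq_add, ← two_smul ℂ, add_neg_cancel, zero_add, smul_smul, smul_smul,
        pauliString_mul, smul_smul]
      have h2 := stringPhase_sq w s
      rw [hs, Int.cast_neg, Int.cast_one] at h2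
      set z : ℂ := 1 / 2 * Complex.I * 2 * stringPhase w s with hz
      have h3 : z * z = 1 := by
        rw [hz]
        linear_combination (Complex.I ^ 2) * h2 - Complex.I_sq
      rcases mul_self_eq_one_iff.mp h3 with h | h
      · left; rw [h, one_smul]
      · right; rw [h, neg_smul, one_smul]
  refine ⟨V, ⟨hVdet, fun s => ?_⟩, hact⟩
  rcases stringSign_eq w s with hs | hs
  · exact ⟨s, Or.inl ((hact s).1 hs)⟩
  · exact ⟨stringAdd w s, (hact s).2 hs⟩

theorem zIndicator_mul_right {V : Unitaries ι} {s t : ι → Fin 4}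
    (h : (V : Op ι) * pauliString s * (V : Op ι)ᴴ = pauliString t ∨
      (V : Op ι) * pauliString s * (V : Op ι)ᴴ = -pauliString t) (U : Unitaries ι) :
    zIndicator (U * V) s = zIndicator U t := by
  simp only [zIndicator, diagEntry, conj_mul]
  rcases h with h | h <;> simp [h]

theorem measurable_zIndicator (s : ι → Fin 4) :
    Measurable fun U : Unitaries ι => zIndicator U s :=
  (Complex.measurable_re.comp (boundedMeasurable_diagEntry _ _).1).pow_const 2

theorem zProb_transvection {w s : ι → Fin 4} (hs : stringSign w s = -1) :
    zProb (globalClifford ι) (stringAdd w s) = zProb (globalClifford ι) s := by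
  obtain ⟨V, hV, hact⟩ := exists_transvection w
  simp only [zProb]
  rw [← integral_mul_right_globalClifford hV (measurable_zIndicator s)]
  simp_rw [zIndicator_mul_right ((hact s).2 hs)]

theorem zProbPair_transvection {w p s : ι → Fin 4} (hp : stringSign w p = 1)
    (hs : stringSign w s = -1) :
    zProbPair (globalClifford ι) p (stringAdd w s) = zProbPair (globalClifford ι) p s := by
  obtain ⟨V, hV, hact⟩ := exists_transvection w
  simp only [zProbPair]
  rw [← integral_mul_right_globalClifford hV (f := fun U => zIndicator U p * zIndicator U s)
    ((measurable_zIndicator p).mul (measurable_zIndicator s))]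
  simp_rw [zIndicator_mul_right ((hact s).2 hs), zIndicator_mul_right (Or.inl ((hact p).1 hp))]

/-- Nondegeneracy of the commutation form over 𝔽₂, as s is not in the span of p. If `r₁`
anticommutes with s and `r₂` with the product of p and s, then `r₁`, `r₂` or their product works. -/
theorem exists_commute_anticommute {p s : ι → Fin 4} (hs : s ≠ 0) (hsp : s ≠ p) :
    ∃ r, stringSign p r = 1 ∧ stringSign s r = -1 := by
  obtain ⟨r₁, h₁⟩ := exists_stringSign_eq_neg_one hs
  have hps : stringAdd p s ≠ 0 := fun h => hsp (eq_of_stringAdd_eq_zero h).symm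
  obtain ⟨r₂, h₂⟩ := exists_stringSign_eq_neg_one hps
  rw [stringSign_add] at h₂
  rcases stringSign_eq p r₁ with hp₁ | hp₁
  · exact ⟨r₁, hp₁, h₁⟩
  rcases stringSign_eq p r₂ with hp₂ | hp₂
  · exact ⟨r₂, hp₂, by rw [hp₂] at h₂; linarith⟩
  · refine ⟨stringAdd r₁ r₂, ?_, ?_⟩
    · rw [stringSign_comm, stringSign_add, stringSign_comm _ p, stringSign_comm _ p, hp₁, hp₂]
      norm_num
    · rw [stringSign_comm, stringSign_add, stringSign_comm _ s, stringSign_comm _ s, h₁]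
      rw [hp₂] at h₂
      linarith

/-- If neither the witness for s nor the one for t serves both, each commutes with the other string,
and their product serves both. -/
theorem exists_commute_anticommute_anticommute {p s t : ι → Fin 4} (hs : s ≠ 0) (hsp : s ≠ p)
    (ht : t ≠ 0) (htp : t ≠ p) :
    ∃ r, stringSign p r = 1 ∧ stringSign s r = -1 ∧ stringSign t r = -1 := by
  obtain ⟨r₁, hp₁, hs₁⟩ := exists_commute_anticommute hs hsp
  obtain ⟨r₂, hp₂, ht₂⟩ := exists_commute_anticommute ht htp
  rcases stringSign_eq t r₁ with ht₁ | ht₁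
  · rcases stringSign_eq s r₂ with hs₂ | hs₂
    · refine ⟨stringAdd r₁ r₂, ?_, ?_, ?_⟩
      all_goals rw [stringSign_comm, stringSign_add, stringSign_comm r₁, stringSign_comm r₂]
      · rw [hp₁, hp₂]; norm_num
      · rw [hs₁, hs₂]; norm_num
      · rw [ht₁, ht₂]; norm_num
    · exact ⟨r₂, hp₂, hs₂, ht₂⟩
  · exact ⟨r₁, hp₁, hs₁, ht₁⟩

/-- The transvections that fix `p` act transitively on the strings other than `0` and `p` that
commute with `p`. -/
theorem eq_of_transvection_invariant {F : (ι → Fin 4) → ℝ} {p : ι → Fin 4}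
    (hF : ∀ w s, stringSign w p = 1 → stringSign w s = -1 → F (stringAdd w s) = F s)
    {s t : ι → Fin 4} (hs : s ≠ 0) (hsp : s ≠ p) (hcs : stringSign p s = 1)
    (ht : t ≠ 0) (htp : t ≠ p) (hct : stringSign p t = 1) : F s = F t := by
  have step : ∀ a b : ι → Fin 4, stringSign p a = 1 → stringSign p b = 1 → stringSign a b = -1 →
      F b = F a := by
    intro a b ha hb hab
    -- For anticommuting a and b the transvection along their product sends a to b, and it fixes p
    -- because both commute with p. A string anticommuting with both s and t then links them in two
    -- such steps.
    have h := hF (stringAdd a b) a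
      (by rw [stringSign_add, stringSign_comm a, stringSign_comm b, ha, hb]; norm_num)
      (by rw [stringSign_add, stringSign_self, stringSign_comm b, hab]; norm_num)
    rwa [stringAdd_comm a b, stringAdd_assoc, stringAdd_self, stringAdd_zero] at h
  obtain ⟨r, hpr, hsr, htr⟩ := exists_commute_anticommute_anticommute hs hsp ht htp
  rw [← step s r hcs hpr hsr, step t r hct hpr htr]

theorem card_strings : (Fintype.card (ι → Fin 4) : ℝ) = (2 ^ Fintype.card ι) ^ 2 := by
  rw [Fintype.card_fun, Fintype.card_fin]
  push_cast
  rw [← pow_mul, mul_comm, pow_mul]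
  norm_num

/-- All nonidentity strings share one probability f, the identity has probability 1, and the sum
rule 1 + (D² - 1) f = D gives f. -/
theorem zProb_globalClifford {s : ι → Fin 4} (hs : s ≠ 0) :
    zProb (globalClifford ι) s = 1 / (2 ^ Fintype.card ι + 1) := by
  have hconst : ∀ t : ι → Fin 4, zProb (globalClifford ι) t =
      zProb (globalClifford ι) s + if t = 0 then 1 - zProb (globalClifford ι) s else 0 := by
    intro t
    split_ifs with ht
    · rw [ht, zProb_zero]; ring
    · rw [add_zero]
      exact eq_of_transvection_invariant (p := 0) (fun w s _ h => zProb_transvection h) ht ht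
        (by rw [stringSign_comm, stringSign_zero]) hs hs (by rw [stringSign_comm, stringSign_zero])
  have hsum := sum_zProb (μ := globalClifford ι)
  rw [Finset.sum_congr rfl fun t _ => hconst t, Finset.sum_add_distrib, Finset.sum_const,
    Finset.card_univ, nsmul_eq_mul, card_strings] at hsum
  simp only [Finset.sum_ite_eq', Finset.mem_univ, if_true] at hsum
  have hD : (1 : ℝ) < 2 ^ Fintype.card ι :=
    one_lt_pow₀ (by norm_num) (card_ne_zero_of_string_ne_zero hs)
  set D : ℝ := 2 ^ Fintype.card ι
  have hfac : (D - 1) * ((D + 1) * zProb (globalClifford ι) s - 1) = 0 := by linear_combination hsum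
  rcases mul_eq_zero.mp hfac with h | h
  · linarith
  · rw [eq_div_iff (by linarith)]
    linarith

theorem zProb_globalClifford_ne_zero (s : ι → Fin 4) : zProb (globalClifford ι) s ≠ 0 := by
  by_cases hs : s = 0
  · rw [hs, zProb_zero]
    exact one_ne_zero
  · rw [zProb_globalClifford hs]
    positivity

theorem sum_stringSign {s : ι → Fin 4} (hs : s ≠ 0) : ∑ t, (stringSign s t : ℝ) = 0 := by
  obtain ⟨r, hr⟩ := exists_stringSign_eq_neg_one hs
  have hinv : Function.Involutive (stringAdd r) := fun t => by
    rw [← stringAdd_assoc, stringAdd_self, stringAdd_comm, stringAdd_zero]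
  have h := Equiv.sum_comp (Function.Involutive.toPerm _ hinv) fun t => (stringSign s t : ℝ)
  have h2 : ∀ t, (stringSign s ((Function.Involutive.toPerm _ hinv) t) : ℝ) = -stringSign s t := by
    intro t
    change (stringSign s (stringAdd r t) : ℝ) = _
    rw [stringSign_comm, stringSign_add, stringSign_comm r, hr, stringSign_comm t]
    simp
  simp_rw [h2, Finset.sum_neg_distrib] at h
  linarith

/-- Fix s. The pair probability is f at 0 and s, a constant c at the other D²/2 - 2 strings
commuting with s, and 0 at the anticommuting ones. The sum rule (D²/2 - 2) c + 2f = D f determines c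
after division by D - 2, hence the exclusion of a single qubit. -/
theorem zProbPair_globalClifford (hι : Fintype.card ι ≠ 1) {s t : ι → Fin 4} (hs : s ≠ 0)
    (ht : t ≠ 0) (hst : t ≠ s) (hcomm : stringSign s t = 1) :
    zProbPair (globalClifford ι) s t =
      2 / ((2 ^ Fintype.card ι + 1) * (2 ^ Fintype.card ι + 2)) := by
  set c := zProbPair (globalClifford ι) s t
  set f := zProb (globalClifford ι) s with hf
  -- The indicator of commuting with s is (1 + sign)/2, and the signs sum to 0; this replaces a
  -- count of commuting strings.
  have hform : ∀ u, zProbPair (globalClifford ι) s u = c / 2 * (1 + stringSign s u) +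
      ((if u = 0 then f - c else 0) + if u = s then f - c else 0) := by
    intro u
    by_cases hu0 : u = 0
    · rw [hu0, zProbPair_zero, stringSign_zero, if_pos rfl, if_neg (Ne.symm hs)]
      push_cast
      ring
    by_cases hus : u = s
    · rw [hus, zProbPair_self ae_isClifford_globalClifford, stringSign_self, if_pos rfl, if_neg hs]
      push_cast
      ring
    rw [if_neg hu0, if_neg hus]
    rcases stringSign_eq s u with hsu | hsu
    · rw [hsu, eq_of_transvection_invariant (p := s) (F := zProbPair (globalClifford ι) s)
        (fun w s h1 h2 => zProbPair_transvection h1 h2) hu0 hus hsu ht hst hcomm]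
      push_cast
      ring
    · rw [hsu, zProbPair_eq_zero ae_isClifford_globalClifford hsu]
      push_cast
      ring
  have hsum := sum_zProbPair (μ := globalClifford ι) s
  rw [Finset.sum_congr rfl fun u _ => hform u, Finset.sum_add_distrib, Finset.sum_add_distrib,
    ← Finset.mul_sum, Finset.sum_add_distrib, sum_stringSign hs, Finset.sum_const,
    Finset.card_univ, nsmul_eq_mul, card_strings] at hsum
  simp only [Finset.sum_ite_eq', Finset.mem_univ, if_true, ← hf] at hsum
  rw [zProb_globalClifford hs] at hf
  have hcard : 2 ≤ Fintype.card ι := by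
    have := card_ne_zero_of_string_ne_zero hs
    omega
  have hD : (4 : ℝ) ≤ 2 ^ Fintype.card ι := by
    calc (4 : ℝ) = 2 ^ 2 := by norm_num
      _ ≤ 2 ^ Fintype.card ι := pow_le_pow_right₀ (by norm_num) hcard
  set D : ℝ := 2 ^ Fintype.card ι
  have hf' : f * (D + 1) = 1 := by
    rw [hf]
    field_simp
  have hfac : (D - 2) * (c * (D + 2) - 2 * f) = 0 := by linear_combination 2 * hsum
  rw [eq_div_iff (by positivity)]
  rcases mul_eq_zero.mp hfac with h | h
  · linarith
  · linear_combination (D + 1) * h + 2 * hf'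

theorem trace_mul_pauliString_swap {τ : Op ι} (hτ : τ.IsHermitian) (s t : ι → Fin 4) :
    (τ * (pauliString t * pauliString s)).trace.re =
      (τ * (pauliString s * pauliString t)).trace.re := by
  rw [← Complex.conj_re]
  change (star (τ * (pauliString t * pauliString s)).trace).re = _
  rw [← Matrix.trace_conjTranspose, Matrix.conjTranspose_mul, Matrix.conjTranspose_mul,
    pauliString_conjTranspose, pauliString_conjTranspose, hτ.eq, Matrix.trace_mul_comm]

theorem sum_coeff_mul_trace (τ : Op ι) {A : Op ι} (hA : A.IsHermitian) :
    ∑ s, ∑ t, (pauliCoeff A s).re * (pauliCoeff A t).re *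
      (τ * (pauliString s * pauliString t)).trace.re = (τ * (A * A)).trace.re := by
  have h : A * A = ∑ s, ∑ t, (((pauliCoeff A s).re * (pauliCoeff A t).re : ℝ) : ℂ) •
      (pauliString s * pauliString t) := by
    conv_lhs => rw [← sum_re_pauliCoeff_smul hA]
    simp only [Finset.sum_mul_sum, smul_mul_smul_comm, Complex.ofReal_mul]
  rw [h]
  simp only [Finset.mul_sum, Matrix.trace_sum, Complex.re_sum, Matrix.mul_smul, Matrix.trace_smul,
    smul_eq_mul, Complex.re_ofReal_mul]

/-- The shadow moment of a traceless observable under global Clifford measurements. -/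
theorem shadowMoment_globalClifford (hι : Fintype.card ι ≠ 1) {τ A : Op ι} (hτ : IsDensity τ)
    (hA : A.IsHermitian) (htr : A.trace = 0) : shadowMoment (globalClifford ι) τ A =
      (2 ^ Fintype.card ι + 1) / (2 ^ Fintype.card ι + 2) *
        (2 * (τ * (A * A)).trace.re + (A * A).trace.re) := by
  rw [shadowMoment_eq_sum ae_isClifford_globalClifford zProb_globalClifford_ne_zero τ hA]
  have hD : (0 : ℝ) < 2 ^ Fintype.card ι := by positivity
  have hY := sum_sq_re_pauliCoeff hA
  have hX := sum_coeff_mul_trace τ hA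
  set α : (ι → Fin 4) → ℝ := fun s => (pauliCoeff A s).re
  set D : ℝ := 2 ^ Fintype.card ι
  have hα0 : α 0 = 0 := by simp [α, pauliCoeff, pauliString_zero, htr]
  set g : (ι → Fin 4) → (ι → Fin 4) → ℝ := fun s t =>
    (τ * (pauliString s * pauliString t)).trace.re
  have hsign : ∀ s t, (stringSign s t : ℝ) * g s t = g t s := by
    intro s t
    have h := pauliString_mul_comm t s
    rw [stringSign_comm] at h
    simp only [g]
    rw [h, Matrix.mul_smul, Matrix.trace_smul, smul_eq_mul]
    have : ((stringSign s t : ℤ) : ℂ) = (((stringSign s t : ℤ) : ℝ) : ℂ) := by push_cast; rfl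
    rw [this, Complex.re_ofReal_mul]
  have hgs : ∀ s, g s s = 1 := fun s => by simp [g, pauliString_mul_self, hτ.2]
  -- The weight of a pair is 2(D+1)/(D+2) if distinct and commuting, 0 if anticommuting, and D + 1
  -- on the diagonal. Since g t s is ± g s t, the symmetric sum covers the first two cases; on the
  -- diagonal it gives 2(D+1)/(D+2), and the last summand supplies the rest.
  have hterm : ∀ s t, (α s / zProb (globalClifford ι) s * (α t / zProb (globalClifford ι) t)) *
      (zProbPair (globalClifford ι) s t * g s t) =
      (D + 1) / (D + 2) * (α s * α t * g s t + α s * α t * g t s) +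
        if s = t then (D + 1) / (D + 2) * D * α s ^ 2 else 0 := by
    intro s t
    by_cases hs : s = 0
    · simp [hs, hα0]
    by_cases ht : t = 0
    · simp [ht, hα0, hs]
    rw [zProb_globalClifford hs, zProb_globalClifford ht]
    by_cases hst : s = t
    · subst hst
      rw [zProbPair_self ae_isClifford_globalClifford, zProb_globalClifford hs, hgs, if_pos rfl]
      field_simp
      ring
    rw [if_neg hst, ← hsign s t]
    rcases stringSign_eq s t with hc | hc
    · rw [zProbPair_globalClifford hι hs ht (Ne.symm hst) hc, hc]
      push_cast
      field_simp
      ring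
    · rw [zProbPair_eq_zero ae_isClifford_globalClifford hc, hc]
      push_cast
      ring
  have hX2 : ∑ s, ∑ t, α s * α t * g t s = (τ * (A * A)).trace.re := by
    rw [← hX, Finset.sum_comm]
    exact Finset.sum_congr rfl fun s _ => Finset.sum_congr rfl fun t _ => by
      simp only [α, g]; ring
  change ∑ s, ∑ t, (α s / zProb (globalClifford ι) s * (α t / zProb (globalClifford ι) t)) *
      (zProbPair (globalClifford ι) s t * g s t) = _
  simp_rw [hterm, Finset.sum_add_distrib, ← Finset.mul_sum, Finset.sum_add_distrib]
  simp only [Finset.sum_ite_eq, Finset.mem_univ, if_true]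
  rw [hX2, ← Finset.mul_sum, mul_assoc _ D, hY]
  have hX' : ∑ s, ∑ t, α s * α t * g s t = (τ * (A * A)).trace.re := hX
  rw [hX']
  ring

/-- The source of the factor 3 in the moment bounds: two parts from tr(τA²) ≤ tr(A²), one from
tr(A²) itself. -/
theorem shadowMoment_globalClifford_le (hι : Fintype.card ι ≠ 1) {τ A : Op ι} (hτ : IsDensity τ)
    (hA : A.IsHermitian) (htr : A.trace = 0) :
    shadowMoment (globalClifford ι) τ A ≤ 3 * (A * A).trace.re := by
  rw [shadowMoment_globalClifford hι hτ hA htr]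
  have h1 := trace_mul_sq_le hτ hA
  have h0 := trace_mul_sq_nonneg hτ hA
  have hD : (0 : ℝ) < 2 ^ Fintype.card ι := by positivity
  have h2 : ((2 : ℝ) ^ Fintype.card ι + 1) / (2 ^ Fintype.card ι + 2) ≤ 1 := by
    rw [div_le_one (by positivity)]
    linarith
  calc _ ≤ 1 * (2 * (τ * (A * A)).trace.re + (A * A).trace.re) :=
        mul_le_mul_of_nonneg_right h2 (by linarith)
    _ ≤ _ := by linarith

end CliffordGroup

/-! ### The single-qubit Clifford primitive. -/

section LocalClifford

variable {ι : Type} [Fintype ι]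

theorem exists_card_eq_locality_supportedOn (A : Op ι) :
    ∃ S : Finset ι, S.card = locality A ∧ SupportedOn A S := by
  -- The whole register is always a support, so the infimum is attained and is not the default 0 of
  -- the empty set.
  have hne : {k | ∃ S : Finset ι, S.card = k ∧ SupportedOn A S}.Nonempty := by
    refine ⟨_, Finset.univ, rfl, fun x y => A (fun q => x ⟨q, Finset.mem_univ q⟩)
      fun q => y ⟨q, Finset.mem_univ q⟩, fun x y => ⟨fun _ => rfl, ?_⟩⟩
    rintro ⟨q, hq, _⟩
    exact absurd (Finset.mem_univ q) hq
  exact Nat.sInf_mem hne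

/-! ### Products of single-qubit Clifford unitaries -/

theorem productOp_conjTranspose (u : ι → Op Unit) :
    (productOp u)ᴴ = productOp fun q => (u q)ᴴ := by
  ext x y
  simp [productOp]

theorem productOp_smul (c : ι → ℂ) (u : ι → Op Unit) :
    (productOp fun q => c q • u q) = (∏ q, c q) • productOp u := by
  ext x y
  simp [productOp, Finset.prod_mul_distrib]

theorem pauliString_eq_productOp (s : ι → Fin 4) :
    pauliString s = productOp fun q => pauliString fun _ : Unit => s q := by
  ext x y
  simp [pauliString, productOp]

variable [DecidableEq ι]

theorem productUnitary_conj_pauliString (u : ι → Unitaries Unit) (s : ι → Fin 4) :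
    (productUnitary u : Op ι) * pauliString s * (productUnitary u : Op ι)ᴴ =
      productOp fun q => (u q : Op Unit) * (pauliString fun _ => s q) * (u q : Op Unit)ᴴ := by
  rw [pauliString_eq_productOp]
  simp only [productUnitary, productOp_conjTranspose, productOp_mul]

theorem isClifford_productUnitary {u : ι → Unitaries Unit} (hu : ∀ q, IsClifford (u q)) :
    IsClifford (productUnitary u) := by
  intro s
  have h : ∀ q, ∃ (e : ℂ) (t : Fin 4), (e = 1 ∨ e = -1) ∧
      (u q : Op Unit) * (pauliString fun _ => s q) * (u q : Op Unit)ᴴ =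
        e • pauliString fun _ => t := by
    intro q
    obtain ⟨t, ht | ht⟩ := hu q fun _ => s q
    · exact ⟨1, t (), Or.inl rfl, by rw [ht, one_smul]⟩
    · exact ⟨-1, t (), Or.inr rfl, by rw [ht, neg_one_smul]⟩
  choose e t he ht using h
  refine ⟨t, ?_⟩
  rw [productUnitary_conj_pauliString]
  simp_rw [ht]
  rw [productOp_smul, ← pauliString_eq_productOp]
  have hprod : ∏ q, e q = 1 ∨ ∏ q, e q = -1 := by
    refine Finset.prod_induction _ (fun z => z = 1 ∨ z = -1) ?_ (Or.inl rfl) fun q _ => he q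
    rintro a b (rfl | rfl) (rfl | rfl) <;> simp
  rcases hprod with h | h
  · left; rw [h, one_smul]
  · right; rw [h, neg_one_smul]

theorem diagEntry_im_of_isHermitian (U : Unitaries ι) (b : Bits ι) {A : Op ι}
    (hA : A.IsHermitian) : (diagEntry U b A).im = 0 := by
  have h : ((U : Op ι) * A * (U : Op ι)ᴴ).IsHermitian :=
    Matrix.isHermitian_mul_mul_conjTranspose _ hA
  exact Complex.conj_eq_iff_im.mp (h.apply b b)

theorem zIndicator_productUnitary (u : ι → Unitaries Unit) (s : ι → Fin 4) :
    zIndicator (productUnitary u) s = ∏ q, zIndicator (u q) fun _ => s q := by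
  have h : diagEntry (productUnitary u) (fun _ => 0) (pauliString s) =
      ((∏ q, (diagEntry (u q) (fun _ => 0) (pauliString fun _ => s q)).re : ℝ) : ℂ) := by
    rw [diagEntry, productUnitary_conj_pauliString, Complex.ofReal_prod]
    refine Finset.prod_congr rfl fun q _ => ?_
    exact Complex.ext rfl (diagEntry_im_of_isHermitian (u q) _ (pauliString_conjTranspose _))
  simp only [zIndicator]
  rw [h, Complex.ofReal_re, Finset.prod_pow]

theorem measurable_productUnitary :
    Measurable (productUnitary : (ι → Unitaries Unit) → Unitaries ι) := by
  rw [measurable_comap_iff]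
  refine measurable_pi_iff.mpr fun x => measurable_pi_iff.mpr fun y => ?_
  have : Measurable fun u : ι → Unitaries Unit =>
      ∏ q, (u q : Op Unit) (fun _ => x q) (fun _ => y q) :=
    Finset.measurable_prod _ fun q _ =>
      (boundedMeasurable_entry (fun _ => x q) (fun _ => y q)).1.comp (measurable_pi_apply q)
  exact this

instance instIsProbabilityMeasureSingleQubitClifford :
    IsProbabilityMeasure (singleQubitClifford ι) :=
  Measure.isProbabilityMeasure_map measurable_productUnitary.aemeasurable

theorem measurableSet_isClifford : MeasurableSet {U : Unitaries ι | IsClifford U} := by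
  have hconj : ∀ (s : ι → Fin 4) (A : Op ι), MeasurableSet {U : Unitaries ι |
      (U : Op ι) * pauliString s * (U : Op ι)ᴴ = A} := by
    intro s A
    have : {U : Unitaries ι | (U : Op ι) * pauliString s * (U : Op ι)ᴴ = A} =
        ⋂ x, ⋂ y, {U : Unitaries ι | ((U : Op ι) * pauliString s * (U : Op ι)ᴴ) x y = A x y} := by
      ext U
      simp [← Matrix.ext_iff]
    rw [this]
    refine MeasurableSet.iInter fun x => MeasurableSet.iInter fun y =>
      measurableSet_eq_fun ?_ measurable_const
    simp only [Matrix.mul_apply, Matrix.conjTranspose_apply]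
    exact (BoundedMeasurable.sum fun j => (BoundedMeasurable.sum fun i =>
      (boundedMeasurable_entry x i).mul (.const _)).mul (boundedMeasurable_entry y j).star).1
  simp only [IsClifford, Set.ofPred_forall, Set.ofPred_exists, Set.ofPred_or]
  exact MeasurableSet.iInter fun s => MeasurableSet.iUnion fun t => (hconj s _).union (hconj s _)

theorem ae_isClifford_singleQubitClifford : ∀ᵐ U ∂singleQubitClifford ι, IsClifford U := by
  rw [singleQubitClifford, ae_map_iff measurable_productUnitary.aemeasurable
    measurableSet_isClifford]
  have h : ∀ᵐ u ∂Measure.pi fun _ : ι => globalClifford Unit, ∀ q, IsClifford (u q) :=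
    ae_all_iff.mpr fun q => (measurePreserving_eval (fun _ : ι => globalClifford Unit)
      q).quasiMeasurePreserving.ae ae_isClifford_globalClifford
  exact h.mono fun u hu => isClifford_productUnitary hu

theorem zProbPair_singleQubitClifford (s t : ι → Fin 4) : zProbPair (singleQubitClifford ι) s t =
    ∏ q, zProbPair (globalClifford Unit) (fun _ => s q) (fun _ => t q) := by
  simp only [zProbPair]
  rw [singleQubitClifford, integral_map (f := fun U : Unitaries ι => zIndicator U s * zIndicator U t)
    measurable_productUnitary.aemeasurable ((measurable_zIndicator s).mul (measurable_zIndicator t)).aestronglyMeasurable]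
  simp_rw [zIndicator_productUnitary, ← Finset.prod_mul_distrib]
  exact integral_fintype_prod_eq_prod (𝕜 := ℝ) fun q (U : Unitaries Unit) =>
    zIndicator U (fun _ => s q) * zIndicator U fun _ => t q

theorem zProb_singleQubitClifford (s : ι → Fin 4) : zProb (singleQubitClifford ι) s =
    ∏ q, zProb (globalClifford Unit) fun _ => s q := by
  rw [← zProbPair_zero, zProbPair_singleQubitClifford]
  exact Finset.prod_congr rfl fun q _ => zProbPair_zero _

theorem zProb_unit (a : Fin 4) :
    zProb (globalClifford Unit) (fun _ => a) = if a = 0 then 1 else 1 / 3 := by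
  split_ifs with h
  · rw [h]
    exact zProb_zero
  · rw [zProb_globalClifford fun h0 => h (congrFun h0 ())]
    norm_num

/-- On one qubit, distinct nonidentity Paulis anticommute, so the pair formula excluded for a single
qubit is not needed. -/
theorem zProbPair_unit (a b : Fin 4) :
    zProbPair (globalClifford Unit) (fun _ => a) (fun _ => b) =
      if b = 0 then zProb (globalClifford Unit) (fun _ => a)
      else if a = 0 ∨ a = b then zProb (globalClifford Unit) (fun _ => b) else 0 := by
  split_ifs with hb hab
  · rw [hb]
    exact zProbPair_zero _
  · rcases hab with rfl | rfl
    · rw [zProbPair_comm]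
      exact zProbPair_zero _
    · exact zProbPair_self ae_isClifford_globalClifford _
  · refine zProbPair_eq_zero ae_isClifford_globalClifford ?_
    rw [not_or] at hab
    simp [stringSign, pauliSign, hb, hab]

theorem zProb_singleQubitClifford_ne_zero (s : ι → Fin 4) :
    zProb (singleQubitClifford ι) s ≠ 0 := by
  rw [zProb_singleQubitClifford]
  refine Finset.prod_ne_zero_iff.mpr fun q _ => ?_
  rw [zProb_unit]
  split_ifs <;> norm_num

/-- The weight of a pair of Pauli strings in the shadow moment. -/
def pairWeight (s t : ι → Fin 4) : ℝ := zProbPair (singleQubitClifford ι) s t /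
  (zProb (singleQubitClifford ι) s * zProb (singleQubitClifford ι) t)

theorem pairWeight_nonneg (s t : ι → Fin 4) : 0 ≤ pairWeight s t :=
  div_nonneg (zProbPair_nonneg _ _) (mul_nonneg (integral_nonneg fun _ => sq_nonneg _)
    (integral_nonneg fun _ => sq_nonneg _))

theorem pairWeight_comm (s t : ι → Fin 4) : pairWeight s t = pairWeight t s := by
  rw [pairWeight, pairWeight, zProbPair_comm, mul_comm]

/-- The single-qubit factor of `pairWeight`. -/
def qubitWeight (a b : Fin 4) : ℝ :=
  if a = 0 ∨ b = 0 then 1 else if a = b then 3 else 0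

theorem pairWeight_eq_prod (s t : ι → Fin 4) :
    pairWeight s t = ∏ q, qubitWeight (s q) (t q) := by
  rw [pairWeight, zProbPair_singleQubitClifford, zProb_singleQubitClifford,
    zProb_singleQubitClifford, ← Finset.prod_mul_distrib, ← Finset.prod_div_distrib]
  refine Finset.prod_congr rfl fun q _ => ?_
  rw [zProbPair_unit, zProb_unit, zProb_unit, qubitWeight]
  by_cases hs : s q = 0 <;> by_cases ht : t q = 0 <;> by_cases hst : s q = t q <;>
    simp_all

/-- The row sum is 1+1+1+1 for the identity and 1+3 for any other Pauli. This is the 4 in 4^k. -/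
theorem sum_qubitWeight (a : Fin 4) : ∑ b, qubitWeight a b = 4 := by
  fin_cases a <;> simp [qubitWeight, Fin.sum_univ_four] <;> norm_num

/-- The Pauli strings that act trivially outside `S`. -/
def stringsOn (S : Finset ι) : Finset (ι → Fin 4) :=
  Fintype.piFinset fun q => if q ∈ S then Finset.univ else {0}

theorem mem_stringsOn {S : Finset ι} {s : ι → Fin 4} :
    s ∈ stringsOn S ↔ ∀ q ∉ S, s q = 0 := by
  simp only [stringsOn, Fintype.mem_piFinset]
  refine forall_congr' fun q => ?_
  by_cases h : q ∈ S <;> simp [h]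

theorem sum_pairWeight (S : Finset ι) (s : ι → Fin 4) :
    ∑ t ∈ stringsOn S, pairWeight s t = 4 ^ S.card := by
  simp_rw [pairWeight_eq_prod]
  have h := Finset.prod_univ_sum (fun q => if q ∈ S then (Finset.univ : Finset (Fin 4)) else {0})
    fun q b => qubitWeight (s q) b
  rw [stringsOn, ← h]
  have hq : ∀ q, ∑ b ∈ (if q ∈ S then (Finset.univ : Finset (Fin 4)) else {0}),
      qubitWeight (s q) b = if q ∈ S then 4 else 1 := by
    intro q
    split_ifs with hqS
    · exact sum_qubitWeight _
    · simp [qubitWeight]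
  simp_rw [hq]
  rw [Finset.prod_ite_mem, Finset.univ_inter, Finset.prod_const]

/-! ### Support -/

theorem pauli_flip (a : Fin 4) (ha : a ≠ 0) (i : Fin 2) :
    pauli a (i + 1) (i + 1) = -pauli a i i := by
  fin_cases a <;> fin_cases i <;> simp [pauli] at ha ⊢

/-- Some qubit q outside S carries a nonidentity Pauli. Flipping bit q in both matrix indices
permutes the terms of the trace. It preserves the entries of A and, wherever A can be nonzero,
negates those of the string, so the trace equals its own negative. -/
theorem pauliCoeff_eq_zero_of_supportedOn {A : Op ι} {S : Finset ι} (hA : SupportedOn A S)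
    {s : ι → Fin 4} (hs : s ∉ stringsOn S) : pauliCoeff A s = 0 := by
  rw [mem_stringsOn] at hs
  push Not at hs
  obtain ⟨q, hqS, hq⟩ := hs
  obtain ⟨A', hA'⟩ := hA
  let flip : Bits ι → Bits ι := fun x => Function.update x q (x q + 1)
  have hflip : Function.Involutive flip := by
    intro x
    have : ∀ i : Fin 2, i + 1 + 1 = i := by decide
    simp [flip, this]
  have hne : ∀ x (r : ι), r ≠ q → flip x r = x r := fun x r hr => Function.update_of_ne hr _ _
  have hterm : ∀ x y, pauliString s (flip x) (flip y) * A (flip y) (flip x) =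
      -(pauliString s x y * A y x) := by
    intro x y
    by_cases hxy : ∀ r ∉ S, y r = x r
    · have hxy' : ∀ r ∉ S, flip y r = flip x r := by
        intro r hr
        by_cases hrq : r = q
        · subst hrq
          simp [flip, hxy r hr]
        · rw [hne _ _ hrq, hne _ _ hrq, hxy r hr]
      have hAeq : A (flip y) (flip x) = A y x := by
        rw [(hA' _ _).1 hxy', (hA' _ _).1 hxy]
        congr 1 <;> ext r : 1 <;> exact hne _ _ fun h => hqS (h ▸ r.2)
      have hP : pauliString s (flip x) (flip y) = -pauliString s x y := by
        simp only [pauliString, Matrix.of_apply]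
        rw [← Finset.mul_prod_erase _ _ (Finset.mem_univ q),
          ← Finset.mul_prod_erase _ _ (Finset.mem_univ q), ← neg_mul]
        congr 1
        · rw [hxy q hqS]
          simp only [flip, Function.update_self, hxy q hqS]
          exact pauli_flip _ hq _
        · refine Finset.prod_congr rfl fun r hr => ?_
          rw [hne _ _ (Finset.ne_of_mem_erase hr), hne _ _ (Finset.ne_of_mem_erase hr)]
      rw [hAeq, hP, neg_mul]
    · have hxy' : ¬∀ r ∉ S, flip y r = flip x r := by
        intro h
        refine hxy fun r hr => ?_
        have := h r hr
        by_cases hrq : r = q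
        · subst hrq
          simpa [flip] using this
        · rwa [hne _ _ hrq, hne _ _ hrq] at this
      push Not at hxy hxy'
      rw [(hA' _ _).2 hxy, (hA' _ _).2 hxy']
      simp
  have hsum : (pauliString s * A).trace = -(pauliString s * A).trace := by
    have h1 : (pauliString s * A).trace = ∑ x, ∑ y, pauliString s x y * A y x := by
      simp only [Matrix.trace, Matrix.diag, Matrix.mul_apply]
    have h2 : ∑ x, ∑ y, pauliString s x y * A y x =
        ∑ x, ∑ y, pauliString s (flip x) (flip y) * A (flip y) (flip x) := by
      rw [← Equiv.sum_comp (Function.Involutive.toPerm flip hflip)]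
      refine Finset.sum_congr rfl fun x _ => ?_
      rw [← Equiv.sum_comp (Function.Involutive.toPerm flip hflip)]
      rfl
    conv_lhs => rw [h1, h2]
    simp_rw [hterm, Finset.sum_neg_distrib]
    rw [h1]
  rw [pauliCoeff, self_eq_neg.mp hsum, mul_zero]

/-! ### The spectral norm -/

/-- Each column is the image of a unit basis vector. -/
theorem sum_sq_norm_le_spectralNorm (A : Op ι) :
    ∑ i, ∑ j, ‖A i j‖ ^ 2 ≤ 2 ^ Fintype.card ι * spectralNorm A ^ 2 := by
  rw [Finset.sum_comm]
  have hcol : ∀ j, ∑ i, ‖A i j‖ ^ 2 ≤ spectralNorm A ^ 2 := by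
    intro j
    have h := (Matrix.toEuclideanCLM (𝕜 := ℂ) A).le_opNorm (EuclideanSpace.single j 1)
    rw [PiLp.norm_single, norm_one, mul_one] at h
    have h2 := pow_le_pow_left₀ (norm_nonneg _) h 2
    rw [EuclideanSpace.norm_sq_eq] at h2
    simpa [spectralNorm, Matrix.ofLp_toEuclideanCLM] using h2
  refine (Finset.sum_le_sum fun j _ => hcol j).trans ?_
  simp

/-- The shadow moment of an observable under local Clifford measurements. -/
theorem shadowMoment_singleQubitClifford_le {τ A : Op ι} (hτ : IsDensity τ)
    (hA : A.IsHermitian) : shadowMoment (singleQubitClifford ι) τ A ≤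
      4 ^ locality A * spectralNorm A ^ 2 := by
  obtain ⟨S, hScard, hS⟩ := exists_card_eq_locality_supportedOn A
  rw [← hScard, shadowMoment_eq_sum ae_isClifford_singleQubitClifford
    zProb_singleQubitClifford_ne_zero τ hA]
  have hsq := sum_sq_re_pauliCoeff hA
  have htr : (A * A).trace.re = ∑ i, ∑ j, ‖A i j‖ ^ 2 := by
    rw [← trace_conjTranspose_mul_self_re, hA.eq]
  set α : (ι → Fin 4) → ℝ := fun s => (pauliCoeff A s).re
  have hα : ∀ s, s ∉ stringsOn S → α s = 0 := fun s hs => by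
    simp [α, pauliCoeff_eq_zero_of_supportedOn hS hs]
  set g : (ι → Fin 4) → (ι → Fin 4) → ℝ := fun s t =>
    (τ * (pauliString s * pauliString t)).trace.re
  -- Expand tr(τ (α_s P_s - α_t P_t)²) ≥ 0.
  have hamgm : ∀ s t, α s * α t * g s t ≤ (α s ^ 2 + α t ^ 2) / 2 := by
    intro s t
    have hH : ((α s : ℂ) • pauliString s - (α t : ℂ) • pauliString t).IsHermitian := by
      simp [Matrix.IsHermitian, Matrix.conjTranspose_sub, Matrix.conjTranspose_smul,
        pauliString_conjTranspose]
    have h0 := trace_mul_sq_nonneg hτ hH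
    have hexp : ((α s : ℂ) • pauliString s - (α t : ℂ) • pauliString t) *
        ((α s : ℂ) • pauliString s - (α t : ℂ) • pauliString t) =
        ((α s ^ 2 + α t ^ 2 : ℝ) : ℂ) • 1 - ((α s * α t : ℝ) : ℂ) •
          (pauliString s * pauliString t) - ((α s * α t : ℝ) : ℂ) •
          (pauliString t * pauliString s) := by
      simp only [sub_mul, mul_sub, smul_mul_smul_comm, pauliString_mul_self, Complex.ofReal_add,
        Complex.ofReal_mul, add_smul, sq, mul_comm (α t : ℂ) (α s : ℂ)]
      abel
    rw [hexp] at h0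
    simp only [mul_sub, Matrix.mul_smul, Matrix.trace_sub, Matrix.trace_smul, smul_eq_mul,
      Complex.sub_re, Complex.re_ofReal_mul, mul_one, hτ.2,
      trace_mul_pauliString_swap hτ.1.isHermitian s t] at h0
    change 0 ≤ _ - α s * α t * g s t - α s * α t * g s t at h0
    rw [Complex.ofReal_re] at h0
    linarith
  have hterm : ∀ s t, (α s / zProb (singleQubitClifford ι) s *
      (α t / zProb (singleQubitClifford ι) t)) * (zProbPair (singleQubitClifford ι) s t * g s t) =
      pairWeight s t * (α s * α t * g s t) := by
    intro s t
    rw [pairWeight]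
    ring
  change ∑ s, ∑ t, (α s / zProb (singleQubitClifford ι) s *
      (α t / zProb (singleQubitClifford ι) t)) *
        (zProbPair (singleQubitClifford ι) s t * g s t) ≤ _
  simp_rw [hterm]
  have hrestrict : ∑ s, ∑ t, pairWeight s t * (α s * α t * g s t) =
      ∑ s ∈ stringsOn S, ∑ t ∈ stringsOn S, pairWeight s t * (α s * α t * g s t) := by
    rw [← Finset.sum_subset (Finset.subset_univ (stringsOn S)) fun s _ hs => by simp [hα s hs]]
    refine Finset.sum_congr rfl fun s _ => ?_
    rw [← Finset.sum_subset (Finset.subset_univ (stringsOn S)) fun t _ ht => by simp [hα t ht]]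
  have hswap : ∑ s ∈ stringsOn S, ∑ t ∈ stringsOn S, pairWeight s t * α t ^ 2 =
      ∑ s ∈ stringsOn S, ∑ t ∈ stringsOn S, pairWeight s t * α s ^ 2 := by
    rw [Finset.sum_comm]
    simp_rw [pairWeight_comm]
  have hrow : ∑ s ∈ stringsOn S, ∑ t ∈ stringsOn S, pairWeight s t * α s ^ 2 =
      4 ^ S.card * ∑ s ∈ stringsOn S, α s ^ 2 := by
    rw [Finset.mul_sum]
    refine Finset.sum_congr rfl fun s _ => ?_
    rw [← Finset.sum_mul, sum_pairWeight]
  have hα2 : ∑ s ∈ stringsOn S, α s ^ 2 ≤ spectralNorm A ^ 2 := by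
    have h1 : ∑ s ∈ stringsOn S, α s ^ 2 ≤ ∑ s, α s ^ 2 :=
      Finset.sum_le_sum_of_subset_of_nonneg (Finset.subset_univ _) fun _ _ _ => sq_nonneg _
    have h2 : (2 : ℝ) ^ Fintype.card ι * ∑ s, α s ^ 2 ≤
        2 ^ Fintype.card ι * spectralNorm A ^ 2 := by
      rw [hsq, htr]
      exact sum_sq_norm_le_spectralNorm A
    exact h1.trans (le_of_mul_le_mul_left h2 (by positivity))
  rw [hrestrict]
  -- Schur test: the weights are nonnegative and symmetric, and every row sums to 4^|S|.
  calc ∑ s ∈ stringsOn S, ∑ t ∈ stringsOn S, pairWeight s t * (α s * α t * g s t)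
      ≤ ∑ s ∈ stringsOn S, ∑ t ∈ stringsOn S,
          (pairWeight s t * α s ^ 2 + pairWeight s t * α t ^ 2) / 2 := by
        refine Finset.sum_le_sum fun s _ => Finset.sum_le_sum fun t _ => ?_
        rw [← mul_add, mul_div_assoc]
        exact mul_le_mul_of_nonneg_left (hamgm s t) (pairWeight_nonneg s t)
    _ = 4 ^ S.card * ∑ s ∈ stringsOn S, α s ^ 2 := by
        simp_rw [← Finset.sum_div, Finset.sum_add_distrib]
        rw [hswap, hrow]
        ring
    _ ≤ 4 ^ S.card * spectralNorm A ^ 2 := mul_le_mul_of_nonneg_left hα2 (by positivity)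

end LocalClifford

/-! ### Tensor-product observables and projections. -/

theorem tensor_isHermitian {ι κ : Type} {A : Op ι} {B : Op κ} (hA : A.IsHermitian) (hB : B.IsHermitian) :
    (tensor A B).IsHermitian := by
  rw [Matrix.IsHermitian, tensor, Matrix.conjTranspose_submatrix, Matrix.conjTranspose_kronecker,
    hA.eq, hB.eq]

section Observables

variable {ι κ : Type} [Fintype ι] [DecidableEq ι] [Fintype κ] [DecidableEq κ]

theorem tensor_mul (A C : Op ι) (B D : Op κ) :
    tensor A B * tensor C D = tensor (A * C) (B * D) := by
  rw [tensor, tensor, tensor, Matrix.submatrix_mul_equiv, Matrix.mul_kronecker_mul]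

theorem trace_tensor (A : Op ι) (B : Op κ) : (tensor A B).trace = A.trace * B.trace := by
  rw [← Matrix.trace_kronecker]
  exact Equiv.sum_comp (Equiv.sumArrowEquivProdArrow ι κ (Fin 2)) fun p => (A ⊗ₖ B) p p

theorem IsPure.mul_self {A : Op ι} (hA : IsPure A) : A * A = A := by
  obtain ⟨ψ, hψ, rfl⟩ := hA
  rw [Matrix.vecMulVec_mul_vecMulVec, hψ, one_smul]

/-- For a projection the C*-identity reads ‖T‖² = ‖T‖. -/
theorem spectralNorm_sq_eq_one {A : Op ι} (hA : A.IsHermitian) (hAA : A * A = A) (h0 : A ≠ 0) :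
    spectralNorm A ^ 2 = 1 := by
  set T := Matrix.toEuclideanCLM (n := Bits ι) (𝕜 := ℂ) A with hT
  have hstar : star T = T := by
    rw [hT, ← map_star, Matrix.star_eq_conjTranspose, hA.eq]
  have hTT : T * T = T := by rw [hT, ← map_mul, hAA]
  have hnorm : ‖T‖ * ‖T‖ = ‖T‖ := by
    have := CStarRing.norm_star_mul_self (x := T)
    rw [hstar, hTT] at this
    exact this.symm
  have hT0 : ‖T‖ ≠ 0 := by
    rw [norm_ne_zero_iff]
    intro h
    exact h0 ((Matrix.toEuclideanCLM (n := Bits ι) (𝕜 := ℂ)).injective (by rw [map_zero]; exact h))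
  have hone : ‖T‖ = 1 := by
    have := mul_right_cancel₀ hT0 (hnorm.trans (one_mul _).symm)
    exact this
  rw [spectralNorm, ← hT, hone, one_pow]

/-- With c = 1/D the left side is tr(A²) - 2c + c²D = tr(A²) - c. Hence making the observable
traceless does not increase the bound. -/
theorem re_trace_sq_sub_smul_one_le {A : Op ι} (htr : A.trace = 1) :
    ((A - (((2 ^ Fintype.card ι)⁻¹ : ℝ) : ℂ) • 1) *
      (A - (((2 ^ Fintype.card ι)⁻¹ : ℝ) : ℂ) • 1)).trace.re ≤ (A * A).trace.re := by
  set c : ℝ := (2 ^ Fintype.card ι)⁻¹ with hc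
  have hone : (1 : Op ι).trace = ((2 ^ Fintype.card ι : ℝ) : ℂ) := by simp
  have hcD : c * 2 ^ Fintype.card ι = 1 := inv_mul_cancel₀ (by positivity)
  have hc0 : 0 < c := by positivity
  have h : ((A - (c : ℂ) • 1) * (A - (c : ℂ) • 1)).trace =
      (A * A).trace - ((2 * c - c * (c * 2 ^ Fintype.card ι) : ℝ) : ℂ) := by
    simp only [sub_mul, mul_sub, Matrix.smul_mul, Matrix.mul_smul, one_mul, mul_one,
      Matrix.trace_sub, Matrix.trace_smul, htr, hone, smul_eq_mul]
    push_cast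
    ring
  rw [h, Complex.sub_re, Complex.ofReal_re, hcD]
  linarith

end Observables

theorem le_iSup_fin {M : ℕ} (f : Fin M → ℝ) (i : Fin M) : f i ≤ ⨆ j, f j :=
  le_ciSup (Set.finite_range f).bddAbove i

end ShadowQPT

end

/-! ### The prediction theorem for the three kinds of primitive. -/

theorem theorem2 :
    ∃ C : ℝ, 0 < C ∧
    ∀ (n M : ℕ) (ρ σ : Fin M → ShadowQPT.Op (Fin n)),
      (∀ i, ShadowQPT.IsDensity (ρ i)) → (∀ i, ShadowQPT.IsDensity (σ i)) →
    ∀ (O : Fin M → ShadowQPT.Op (Fin n ⊕ Fin n)),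
      (∀ i, O i = ShadowQPT.tensor (ρ i)ᵀ (σ i)) →
    ∀ (ε δ : ℝ), 0 < ε → ε < 1 → 0 < δ → δ < 1 →
      -- Any tomographically complete measurement primitive. The identity is subtracted with the
      -- weight tr(O)/2; the trace-free normalization tr(O)/2^(2n) is covered as well.
      (∀ (μ : Measure (ShadowQPT.Unitaries (Fin n ⊕ Fin n))), IsProbabilityMeasure μ →
        ShadowQPT.TomographicallyComplete μ →
        ∀ s ∈ ({2, 2 ^ (2 * n)} : Set ℂ),
        (∀ K B : ℕ, 2 * Real.log (2 * M / δ) ≤ K → 0 < B →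
          34 / ε ^ 2 *
            (⨆ i, ShadowQPT.shadowNorm μ (O i - ((O i).trace / s) • 1) ^ 2) ≤ B →
          ShadowQPT.MedianOfMeansPredicts μ O ε δ K B) ∧
        (∀ T : ℕ,
          C * (Real.log (2 * M / δ) / ε ^ 2 *
            ⨆ i, ShadowQPT.shadowNorm μ (O i - ((O i).trace / s) • 1) ^ 2) ≤ T →
          ShadowQPT.MeasurementsSuffice μ O ε δ T)) ∧
      -- Random global Clifford measurements.
      (∀ K B : ℕ, 2 * Real.log (2 * M / δ) ≤ K → 0 < B →
        34 / ε ^ 2 * (⨆ i, (O i * O i).trace.re) ≤ B →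
        ShadowQPT.MedianOfMeansPredicts
          (ShadowQPT.globalClifford (Fin n ⊕ Fin n)) O ε δ K B) ∧
      (∀ T : ℕ, C * (Real.log (2 * M / δ) / ε ^ 2 * ⨆ i, (O i * O i).trace.re) ≤ T →
        ShadowQPT.MeasurementsSuffice
          (ShadowQPT.globalClifford (Fin n ⊕ Fin n)) O ε δ T) ∧
      (∀ i, ShadowQPT.IsPure (ρ i) → ShadowQPT.IsPure (σ i) → (O i * O i).trace = 1) ∧
      -- Random single-qubit Clifford measurements.
      (∀ K B : ℕ, 2 * Real.log (2 * M / δ) ≤ K → 0 < B →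
        34 / ε ^ 2 * (⨆ i, 4 ^ ShadowQPT.locality (O i) * ShadowQPT.spectralNorm (O i) ^ 2) ≤ B →
        ShadowQPT.MedianOfMeansPredicts
          (ShadowQPT.singleQubitClifford (Fin n ⊕ Fin n)) O ε δ K B) ∧
      (∀ T : ℕ, C * (Real.log (2 * M / δ) / ε ^ 2 *
          ⨆ i, 4 ^ ShadowQPT.locality (O i) * ShadowQPT.spectralNorm (O i) ^ 2) ≤ T →
        ShadowQPT.MeasurementsSuffice
          (ShadowQPT.singleQubitClifford (Fin n ⊕ Fin n)) O ε δ T) ∧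
      (∀ i, ShadowQPT.IsPure (ρ i) → ShadowQPT.IsPure (σ i) →
        ShadowQPT.spectralNorm (O i) ^ 2 = 1) := by
  refine ⟨148, by norm_num, ?_⟩
  intro n M ρ σ hρ hσ O hO ε δ hε _ hδ hδ1
  have htr : ∀ i, (O i).trace = 1 := fun i => by
    rw [hO, ShadowQPT.trace_tensor, Matrix.trace_transpose, (hρ i).2, (hσ i).2, one_mul]
  have hH : ∀ i, (O i).IsHermitian := fun i => by
    rw [hO]
    exact ShadowQPT.tensor_isHermitian (hρ i).1.isHermitian.transpose (hσ i).1.isHermitian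
  have hproj : ∀ i, ShadowQPT.IsPure (ρ i) → ShadowQPT.IsPure (σ i) → O i * O i = O i := by
    intro i hρi hσi
    rw [hO, ShadowQPT.tensor_mul, ← Matrix.transpose_mul, hρi.mul_self, hσi.mul_self]
  have hne : ∀ i, O i ≠ 0 := by
    intro i h
    have := htr i
    rw [h, Matrix.trace_zero] at this
    exact zero_ne_one this
  -- The Choi register has an even number of qubits, which avoids the exceptional single-qubit case.
  have hcard : Fintype.card (Fin n ⊕ Fin n) ≠ 1 := by
    rw [Fintype.card_sum, Fintype.card_fin]
    omega
  -- The centre 2^(-2n) makes O_i traceless, as the global moment formula requires.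
  have hglobal : ∀ i τ, ShadowQPT.IsDensity τ →
      ShadowQPT.shadowMoment (ShadowQPT.globalClifford (Fin n ⊕ Fin n)) τ
        (O i - (((2 ^ Fintype.card (Fin n ⊕ Fin n))⁻¹ : ℝ) : ℂ) • 1) ≤
          3 * ⨆ i, (O i * O i).trace.re := by
    intro i τ hτ
    refine (ShadowQPT.shadowMoment_globalClifford_le hcard hτ ?_ ?_).trans
      (mul_le_mul_of_nonneg_left ((ShadowQPT.re_trace_sq_sub_smul_one_le (htr i)).trans
        (ShadowQPT.le_iSup_fin (fun i => (O i * O i).trace.re) i)) (by norm_num))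
    · refine (hH i).sub ?_
      rw [Matrix.IsHermitian, Matrix.conjTranspose_smul, Matrix.conjTranspose_one]
      congr 1
      exact Complex.conj_ofReal _
    · rw [Matrix.trace_sub, htr, Matrix.trace_smul]
      simp
  -- Here the centre is 0: subtracting a multiple of the identity is not needed for the local bound.
  have hlocal : ∀ i τ, ShadowQPT.IsDensity τ →
      ShadowQPT.shadowMoment (ShadowQPT.singleQubitClifford (Fin n ⊕ Fin n)) τ
        (O i - ((0 : ℝ) : ℂ) • 1) ≤
          3 * ⨆ i, 4 ^ ShadowQPT.locality (O i) * ShadowQPT.spectralNorm (O i) ^ 2 := by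
    intro i τ hτ
    rw [Complex.ofReal_zero, zero_smul, sub_zero]
    have h1 := ShadowQPT.shadowMoment_singleQubitClifford_le hτ (hH i)
    have h2 := ShadowQPT.le_iSup_fin
      (fun i => 4 ^ ShadowQPT.locality (O i) * ShadowQPT.spectralNorm (O i) ^ 2) i
    have h3 : (0 : ℝ) ≤ 4 ^ ShadowQPT.locality (O i) * ShadowQPT.spectralNorm (O i) ^ 2 := by
      positivity
    linarith
  have hglobalTC := ShadowQPT.tomographicallyComplete_of_zProb (ι := Fin n ⊕ Fin n)
    ShadowQPT.ae_isClifford_globalClifford ShadowQPT.zProb_globalClifford_ne_zero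
  have hlocalTC := ShadowQPT.tomographicallyComplete_of_zProb (ι := Fin n ⊕ Fin n)
    ShadowQPT.ae_isClifford_singleQubitClifford ShadowQPT.zProb_singleQubitClifford_ne_zero
  refine ⟨?_, ?_, ?_, ?_, ?_, ?_, ?_⟩
  · intro μ hμ hTC s hs
    -- As tr O_i = 1, both normalizations subtract a real multiple of the identity, and any real
    -- centre is allowed.
    obtain ⟨c, hc⟩ : ∃ c : ℝ, ∀ i, (O i).trace / s = (c : ℂ) := by
      rcases hs with rfl | rfl
      · exact ⟨1 / 2, fun i => by rw [htr]; push_cast; rfl⟩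
      · exact ⟨1 / 2 ^ (2 * n), fun i => by rw [htr]; push_cast; rfl⟩
    simp_rw [hc]
    have hV : ∀ i τ, ShadowQPT.IsDensity τ →
        ShadowQPT.shadowMoment μ τ (O i - (c : ℂ) • 1) ≤
          3 * ⨆ i, ShadowQPT.shadowNorm μ (O i - (c : ℂ) • 1) ^ 2 := by
      intro i τ hτ
      have h1 := ShadowQPT.shadowMoment_le_sq_shadowNorm (μ := μ) hτ (O i - (c : ℂ) • 1)
      have h2 := ShadowQPT.le_iSup_fin
        (fun i => ShadowQPT.shadowNorm μ (O i - (c : ℂ) • 1) ^ 2) i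
      have h3 := sq_nonneg (ShadowQPT.shadowNorm μ (O i - (c : ℂ) • 1))
      linarith
    exact ⟨fun K B hK hB hBV =>
        ShadowQPT.medianOfMeansPredicts_of_shadowMoment_le hTC hV hε hδ hK hB hBV,
      fun T hT => ShadowQPT.measurementsSuffice_of_shadowMoment_le hTC hV hε hδ hδ1 hT⟩
  · exact fun K B hK hB hBV =>
      ShadowQPT.medianOfMeansPredicts_of_shadowMoment_le hglobalTC hglobal hε hδ hK hB hBV
  · exact fun T hT =>
      ShadowQPT.measurementsSuffice_of_shadowMoment_le hglobalTC hglobal hε hδ hδ1 hT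
  · intro i hρi hσi
    rw [hproj i hρi hσi, htr]
  · exact fun K B hK hB hBV =>
      ShadowQPT.medianOfMeansPredicts_of_shadowMoment_le hlocalTC hlocal hε hδ hK hB hBV
  · exact fun T hT =>
      ShadowQPT.measurementsSuffice_of_shadowMoment_le hlocalTC hlocal hε hδ hδ1 hT
  · exact fun i hρi hσi => ShadowQPT.spectralNorm_sq_eq_one (hH i) (hproj i hρi hσi) (hne i)
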